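/- Let $(S_n)_{n\ge 0}$ be a random walk on $\mathbb{R}$ with $S_0=0$ and i.i.d. steps satisfying $\mathbf{E}[S_1]=0$ and $\sigma^2=\mathbf{E}[S_1^2]\in(0,\infty)$. Let $U^-$ be the renewal measure of its weak descending ladder heights, i.e. $U^-(B)$ is the expected number of weak descending ladder epochs (the times $n\ge 0$ with $S_n\le S_k$ for all $0\le k<n$, including $n=0$) for which $-S_n\in B$. Put $R(0):=1$ and $R(x):=U^-([0,x))$ for $x>0$. Let $(\zeta_n)_{n\ge 0}$ be the random walk conditioned to stay positive, started from $\zeta_0=0$; that is, for all $n\ge 0$ and all measurable $g:\mathbb{R}^{n+1}\to[0,\infty]$, $$\mathbf{E}\big[g(\zeta_0,\dots,\zeta_n)\big]=\frac{1}{R(0)}\,\mathbf{E}\Big[g(S_0,\dots,S_n)\,R(S_n)\,\mathbf{1}_{\{S_k>0\text{ for all }1\le k\le n\}}\Big].$$ Let $F:[0,\infty)\to[0,\infty)$ be non-increasing. Then $$\int_0^\infty F(y)\,y\,\mathrm{d}y=\infty\quad\Longleftrightarrow\quad \sum_{n\ge 0}F(\zeta_n)=\infty\ \text{ almost surely.}$$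 -/

import Mathlib

open MeasureTheory ProbabilityTheory Set
open scoped ENNReal

noncomputable section

namespace ConditionedWalk

/-- The random walk started at `0` with steps `X 0, X 1, …`: `S 0 = 0`, `S n = X 0 + ⋯ + X (n - 1)`. -/
def walk {Ω : Type*} (X : ℕ → Ω → ℝ) (n : ℕ) (ω : Ω) : ℝ :=
  ∑ i ∈ Finset.range n, X i ω

/-- The event that `n` is a weak descending ladder epoch of the process `S`: `S n` is at most every
earlier value. The epoch `0` is always one; the following ones are the successive times at which
the path is at or below its value at the preceding ladder epoch. -/
def weakDescLadderEvent {Ω : Type*} (S : ℕ → Ω → ℝ) (n : ℕ) : Set Ω :=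
  {ω | ∀ k < n, S n ω ≤ S k ω}

/-- The renewal measure of the weak descending ladder height process of `S`, for a process `S`
with `S 0 = 0`: the mass of `B` is the expected number of weak descending ladder epochs `n`
(including `n = 0`) whose ladder height `- S n` lies in `B`. -/
def weakDescRenewalMeasure {Ω : Type*} [MeasurableSpace Ω] (P : Measure Ω) (S : ℕ → Ω → ℝ) :
    Measure ℝ :=
  Measure.sum fun n => (P.restrict (weakDescLadderEvent S n)).map (fun ω => -S n ω)

/-- The function `R`: `R 0 = 1` and, for `x > 0`, `R x` is the mass that the renewal measure of the
weak descending ladder heights gives to `[0, x)`. Its values at `x < 0` are never used. -/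
def renewalFn {Ω : Type*} [MeasurableSpace Ω] (P : Measure Ω) (S : ℕ → Ω → ℝ) (x : ℝ) : ℝ≥0∞ :=
  if 0 < x then weakDescRenewalMeasure P S (Ico 0 x) else 1

/-- `ζ` (on the probability space `(Ω', P')`) is a version of the walk `S` (on `(Ω, P)`, with
`S 0 = 0`) conditioned to stay positive and started at `0`. That is, its law is the Doob transform
by `R` of the walk killed on entering `(-∞, 0]` at a time `≥ 1`: for each `n` and each measurable
`g ≥ 0`,
`E[g(ζ 0, …, ζ n)] = R(0)⁻¹ * E[g(S 0, …, S n) R(S n) ; S 1 > 0, …, S n > 0]`. -/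
structure IsConditionedToStayPositive {Ω Ω' : Type*} [MeasurableSpace Ω] [MeasurableSpace Ω']
    (P : Measure Ω) (S : ℕ → Ω → ℝ) (P' : Measure Ω') (ζ : ℕ → Ω' → ℝ) : Prop where
  measurable : ∀ n, Measurable (ζ n)
  law : ∀ (n : ℕ) (g : (Fin (n + 1) → ℝ) → ℝ≥0∞), Measurable g →
    ∫⁻ ω', g (fun i => ζ i ω') ∂P' =
      (renewalFn P S 0)⁻¹ *
        ∫⁻ ω in {ω | ∀ k, 1 ≤ k → k ≤ n → 0 < S k ω},
          g (fun i => S i ω) * renewalFn P S (S n ω) ∂P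

end ConditionedWalk

end

/-!
Write `R` for the renewal function, `G x` for the Green measure of the walk started at `x` and
killed on entering `(-∞, 0]`, and `V t` for the expected time that the walk started at `0` spends
below `t` before its first return to `(-∞, 0]`. Cutting a positive path at its last minimum `z`
shows that `G x` is the integral, with respect to a measure of mass `R x` on the ladder heights
`z ∈ [0, x]`, of the occupation measures of the walk started at `z` and staying above `z`. Both
`R` and `V` grow linearly: a step `≤ -δ` from a ladder height leaves an interval of length `δ` for
good, which bounds `R` from above; reversal of time bounds `V` by the renewal function of `-S`;
and the exit time from `(-s, s)` has mean at least `s² / σ²`, so that `V * R` is at least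
quadratic.

The Green measure of the conditioned walk is thus comparable to `y dy`, uniformly in its starting
point `x`, the lower bound being restricted to non-increasing weights that are constant up to a
multiple of `1 + x`. Hence `E ∑ F (ζ n)` is finite when `∫ F(y) y dy` is. When this integral is
infinite, truncate `F` to get weights with finite but arbitrarily large integrals. The Markov
property bounds the second moments of the corresponding sums by the squares of their means, and
the Paley–Zygmund inequality then shows that `∑ F (ζ n) = ∞` has probability at least `κ > 0`
given any cylinder event. Since cylinders approximate the complement of `{∑ F (ζ n) = ∞}`, it is
null.
-/

noncomputable section

namespace ConditionedWalk

section Path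

variable {Ω : Type*}

/-- The path, started at `x`, of the walk with steps `X`. The starting point enters the path and not
the measure: the walk started at `x` has the law of `path X x` under `P`. -/
def path (X : ℕ → Ω → ℝ) (x : ℝ) (ω : Ω) (n : ℕ) : ℝ :=
  x + walk X n ω

variable (X : ℕ → Ω → ℝ) (x : ℝ) (ω : Ω) (n : ℕ)

@[simp] lemma path_zero : path X x ω 0 = x := by simp [path, walk]

lemma path_succ : path X x ω (n + 1) = path X x ω n + X n ω := by
  simp only [path, walk, Finset.sum_range_succ, add_assoc]

lemma path_add (k : ℕ) :
    path X x ω (n + k) = path (fun i => X (n + i)) (path X x ω n) ω k := by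
  simp only [path, walk, Finset.sum_range_add, add_assoc]

lemma path_eq_add : path X x ω n = x + path X 0 ω n := by simp only [path, zero_add]

lemma walk_eq_path : walk X n ω = path X 0 ω n := by simp only [path, zero_add]

variable {X} in
lemma measurable_uncurry_path [MeasurableSpace Ω] (hX : ∀ i, Measurable (X i)) :
    Measurable fun p : ℝ × Ω => path X p.1 p.2 := by
  unfold path walk
  fun_prop

end Path

section Lintegral

variable {Ω α β : Type*} [MeasurableSpace Ω] [MeasurableSpace α] [MeasurableSpace β]
  {P : Measure Ω} [IsFiniteMeasure P]

lemma lintegral_uncurry_of_indepFun {Y : Ω → α} {Z : Ω → β} (hYZ : IndepFun Y Z P)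
    (hY : Measurable Y) (hZ : Measurable Z) {f : α → β → ℝ≥0∞}
    (hf : Measurable (Function.uncurry f)) :
    ∫⁻ ω, f (Y ω) (Z ω) ∂P = ∫⁻ ω, ∫⁻ z, f (Y ω) z ∂(P.map Z) ∂P := by
  have hlaw := (indepFun_iff_map_prod_eq_prod_map_map hY.aemeasurable hZ.aemeasurable).1 hYZ
  have := Measure.isFiniteMeasure_map P Z
  calc ∫⁻ ω, f (Y ω) (Z ω) ∂P
      = ∫⁻ p, Function.uncurry f p ∂(P.map fun ω => (Y ω, Z ω)) :=
        (lintegral_map hf (hY.prodMk hZ)).symm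
    _ = ∫⁻ ω, ∫⁻ z, f (Y ω) z ∂(P.map Z) ∂P := by
        rw [hlaw, lintegral_prod _ hf.aemeasurable, lintegral_map hf.lintegral_prod_right' hY]
        rfl

end Lintegral

/-- The steps `X 0, X 1, …` are measurable, independent and identically distributed. -/
structure IsIIDSteps {Ω : Type*} [MeasurableSpace Ω] (P : Measure Ω) (X : ℕ → Ω → ℝ) : Prop where
  measurable : ∀ n, Measurable (X n)
  indep : iIndepFun X P
  ident : ∀ n, IdentDistrib (X n) (X 0) P P

namespace IsIIDSteps

variable {Ω : Type*} [MeasurableSpace Ω] {P : Measure Ω} {X : ℕ → Ω → ℝ}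

lemma measurable_path (h : IsIIDSteps P X) (x : ℝ) : Measurable (path X x) :=
  (measurable_uncurry_path h.measurable).of_uncurry_left

lemma measurable_path_apply (h : IsIIDSteps P X) (x : ℝ) (n : ℕ) :
    Measurable fun ω => path X x ω n :=
  measurable_pi_iff.1 (h.measurable_path x) n

lemma map_precomp (h : IsIIDSteps P X) {e : ℕ → ℕ} (he : Function.Injective e) :
    P.map (fun ω i => X (e i) ω) = P.map (fun ω i => X i ω) := by
  rw [(h.indep.precomp he).map_fun_eq_infinitePi_map (fun i => h.measurable _),
    h.indep.map_fun_eq_infinitePi_map h.measurable]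
  congr 1
  funext i
  rw [(h.ident (e i)).map_eq, (h.ident i).map_eq]

lemma lintegral_path_precomp (h : IsIIDSteps P X) {e : ℕ → ℕ} (he : Function.Injective e)
    {f : (ℕ → ℝ) → ℝ≥0∞} (hf : Measurable f) (x : ℝ) :
    ∫⁻ ω, f (path (fun i => X (e i)) x ω) ∂P = ∫⁻ ω, f (path X x ω) ∂P := by
  have hpath : Measurable (path (fun i (s : ℕ → ℝ) => s i) x) :=
    (measurable_uncurry_path measurable_pi_apply).of_uncurry_left
  calc ∫⁻ ω, f (path (fun i => X (e i)) x ω) ∂P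
      = ∫⁻ s, f (path (fun i s => s i) x s) ∂(P.map fun ω i => X (e i) ω) :=
        (lintegral_map (hf.comp hpath) (measurable_pi_iff.2 fun i => h.measurable _)).symm
    _ = ∫⁻ ω, f (path X x ω) ∂P := by
        rw [h.map_precomp he]
        exact lintegral_map (hf.comp hpath) (measurable_pi_iff.2 h.measurable)

lemma indepFun_past_future (h : IsIIDSteps P X) (n : ℕ) :
    IndepFun (fun ω k => if k < n then X k ω else 0) (fun ω k => X (n + k) ω) P := by
  have hdisj : Disjoint (Iio n) (Ici n) := Set.Iio_disjoint_Ici le_rfl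
  have hind := indep_iSup_of_disjoint (m := fun i => MeasurableSpace.comap (X i) inferInstance)
    (fun i => (h.measurable i).comap_le) h.indep hdisj
  have hmeas {S : Set ℕ} {i : ℕ} (hi : i ∈ S) :
      Measurable[⨆ j ∈ S, MeasurableSpace.comap (X j) inferInstance] (X i) :=
    (comap_measurable (X i)).mono (le_iSup₂_of_le i hi le_rfl) le_rfl
  refine indep_of_indep_of_le_left (indep_of_indep_of_le_right hind ?_) ?_
  · exact (@measurable_pi_iff _ _ _ (_) _ _).2 (fun k => hmeas (Nat.le_add_right n k))
      |>.comap_le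
  · refine Measurable.comap_le ((@measurable_pi_iff _ _ _ (_) _ _).2 fun k => ?_)
    by_cases hk : k < n
    · simpa only [if_pos hk] using hmeas (i := k) hk
    · simpa only [if_neg hk] using measurable_const

lemma measurable_lintegral_path [IsProbabilityMeasure P] (h : IsIIDSteps P X)
    {f : (ℕ → ℝ) → ℝ≥0∞} (hf : Measurable f) : Measurable fun x => ∫⁻ ω, f (path X x ω) ∂P :=
  Measurable.lintegral_prod_right (hf.comp (measurable_uncurry_path h.measurable))

lemma lintegral_markov [IsProbabilityMeasure P] (h : IsIIDSteps P X) {n : ℕ}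
    {f g : (ℕ → ℝ) → ℝ≥0∞} (hf : Measurable f) (hfn : DependsOn f (Iic n)) (hg : Measurable g)
    (x : ℝ) :
    ∫⁻ ω, f (path X x ω) * g (fun k => path X x ω (n + k)) ∂P =
      ∫⁻ ω, f (path X x ω) * ∫⁻ ω', g (path X (path X x ω n) ω') ∂P ∂P := by
  have hX := h.measurable
  set past : Ω → ℕ → ℝ := fun ω k => if k < n then X k ω else 0
  have hmpast : Measurable past := measurable_pi_iff.2 fun k => by
    by_cases hk : k < n <;> simp [past, hk, hX]
  set T : ℝ → (ℕ → ℝ) → ℕ → ℝ := path fun i s => s i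
  have hT : Measurable fun p : ℝ × (ℕ → ℝ) => T p.1 p.2 :=
    measurable_uncurry_path measurable_pi_apply
  have hpath (ω : Ω) : ∀ k ≤ n, path X x ω k = T x (past ω) k := fun k hk =>
    congr_arg (x + ·) <| Finset.sum_congr rfl fun i hi => by
      simp only [past, if_pos ((Finset.mem_range.1 hi).trans_le hk)]
  have hfpast (ω : Ω) : f (path X x ω) = f (T x (past ω)) := hfn fun k hk => hpath ω k hk
  have hshift : P.map (fun ω k => X (n + k) ω) = P.map (fun ω k => X k ω) :=
    h.map_precomp (add_right_injective n)
  calc ∫⁻ ω, f (path X x ω) * g (fun k => path X x ω (n + k)) ∂P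
      = ∫⁻ ω, f (T x (past ω)) * g (T (T x (past ω) n) fun k => X (n + k) ω) ∂P :=
        lintegral_congr fun ω => by
          rw [hfpast, ← hpath ω n le_rfl]
          exact congr_arg (_ * g ·) (funext fun k => path_add X x ω n k)
    _ = ∫⁻ ω, ∫⁻ t, f (T x (past ω)) * g (T (T x (past ω) n) t) ∂(P.map fun ω k => X k ω) ∂P := by
        rw [← hshift]
        exact lintegral_uncurry_of_indepFun (h.indepFun_past_future n) hmpast (by fun_prop)
          (f := fun s t => f (T x s) * g (T (T x s n) t)) (by fun_prop)
    _ = ∫⁻ ω, f (path X x ω) * ∫⁻ ω', g (path X (path X x ω n) ω') ∂P ∂P :=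
        lintegral_congr fun ω => by
          rw [lintegral_const_mul _ (by fun_prop), lintegral_map (by fun_prop) (by fun_prop),
            ← hfpast, ← hpath ω n le_rfl]
          rfl

lemma lintegral_reverse (h : IsIIDSteps P X) (n : ℕ) {f : (ℕ → ℝ) → ℝ≥0∞} (hf : Measurable f)
    (hdep : DependsOn f (Iic n)) :
    ∫⁻ ω, f (fun k => path X 0 ω n - path X 0 ω (n - k)) ∂P = ∫⁻ ω, f (path X 0 ω) ∂P := by
  set e : ℕ → ℕ := fun i => if i < n then n - 1 - i else i
  have he : Function.Injective e := fun i j hij => by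
    simp only [e] at hij
    split_ifs at hij <;> omega
  have hrev (ω : Ω) : ∀ k ≤ n,
      path X 0 ω n - path X 0 ω (n - k) = path (fun i => X (e i)) 0 ω k := fun k hk => by
    induction k with
    | zero => simp
    | succ k ih =>
      have hstep := path_succ X 0 ω (n - (k + 1))
      rw [show n - (k + 1) + 1 = n - k by omega] at hstep
      rw [path_succ, ← ih (by omega), hstep, show e k = n - (k + 1) by grind]
      ring
  rw [← h.lintegral_path_precomp he hf 0]
  exact lintegral_congr fun ω => hdep fun k hk => hrev ω k hk

end IsIIDSteps

section Excursions

/-- Paths that are positive at the times `1, …, n`. -/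
def stayPositive (n : ℕ) : Set (ℕ → ℝ) :=
  {v | ∀ k, 1 ≤ k → k ≤ n → 0 < v k}

/-- Paths that are above their starting point at the times `1, …, n`. -/
def stayAboveStart (n : ℕ) : Set (ℕ → ℝ) :=
  {v | ∀ k, 1 ≤ k → k ≤ n → v 0 < v k}

/-- Paths that have a weak descending ladder epoch at time `n` and are positive then; positivity is
not required of the epoch `0`, so that the starting point always counts. -/
def positiveLadder (n : ℕ) : Set (ℕ → ℝ) :=
  {v | (∀ k < n, v n ≤ v k) ∧ (n = 0 ∨ 0 < v n)}

lemma measurableSet_stayPositive (n : ℕ) : MeasurableSet (stayPositive n) := by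
  simp only [stayPositive, ofPred_forall]
  exact .iInter fun k => .iInter fun _ => .iInter fun _ =>
    measurableSet_lt measurable_const (measurable_pi_apply k)

lemma measurableSet_stayAboveStart (n : ℕ) : MeasurableSet (stayAboveStart n) := by
  simp only [stayAboveStart, ofPred_forall]
  exact .iInter fun k => .iInter fun _ => .iInter fun _ =>
    measurableSet_lt (measurable_pi_apply 0) (measurable_pi_apply k)

lemma measurableSet_weakDescLadderEvent {Ω : Type*} [MeasurableSpace Ω] {S : ℕ → Ω → ℝ}
    (hS : ∀ n, Measurable (S n)) (n : ℕ) : MeasurableSet (weakDescLadderEvent S n) := by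
  simp only [weakDescLadderEvent, ofPred_forall]
  exact .iInter fun k => .iInter fun _ => measurableSet_le (hS n) (hS k)

lemma measurableSet_positiveLadder (n : ℕ) : MeasurableSet (positiveLadder n) :=
  (measurableSet_weakDescLadderEvent measurable_pi_apply n).inter
    ((MeasurableSet.const _).union (measurableSet_lt measurable_const (measurable_pi_apply n)))

lemma dependsOn_indicator {W : Set (ℕ → ℝ)} {n : ℕ} (hW : DependsOn (· ∈ W) (Iic n)) :
    DependsOn (W.indicator (1 : (ℕ → ℝ) → ℝ≥0∞)) (Iic n) := fun _ _ huv =>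
  indicator_eq_indicator (hW huv).to_iff rfl

lemma dependsOn_stayPositive (n : ℕ) : DependsOn (· ∈ stayPositive n) (Iic n) := fun _ _ huv =>
  propext <| forall₃_congr fun k _ hk => by rw [huv k hk]

lemma dependsOn_stayAboveStart (n : ℕ) : DependsOn (· ∈ stayAboveStart n) (Iic n) :=
  fun _ _ huv => propext <| forall₃_congr fun k _ hk => by rw [huv k hk, huv 0 (Nat.zero_le n)]

lemma dependsOn_weakDescLadderEvent (n : ℕ) :
    DependsOn (· ∈ weakDescLadderEvent (fun k (v : ℕ → ℝ) => v k) n) (Iic n) := fun _ _ huv =>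
  propext <| forall₂_congr fun k hk => by
    simp only [huv n self_mem_Iic, huv k (mem_Iic.2 hk.le)]

lemma dependsOn_positiveLadder (n : ℕ) : DependsOn (· ∈ positiveLadder n) (Iic n) :=
  fun _ _ huv => propext <|
    and_congr (dependsOn_weakDescLadderEvent n huv).to_iff (by rw [huv n self_mem_Iic])

lemma exists_last_min (v : ℕ → ℝ) (N : ℕ) :
    ∃ n ≤ N, (∀ k ≤ N, v n ≤ v k) ∧ ∀ k, n < k → k ≤ N → v n < v k := by
  obtain ⟨n, hn, hmin⟩ := Finset.exists_min_image (Finset.range (N + 1))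
    (fun k => toLex (v k, OrderDual.toDual k)) Finset.nonempty_range_add_one
  have hlex (k : ℕ) (hk : k ≤ N) : v n < v k ∨ v n = v k ∧ k ≤ n :=
    Prod.Lex.toLex_le_toLex.1 (hmin k (Finset.mem_range_succ_iff.2 hk))
  refine ⟨n, Finset.mem_range_succ_iff.1 hn, fun k hk => ?_, fun k hnk hk => ?_⟩
  · exact (hlex k hk).elim le_of_lt fun h => h.1.le
  · exact (hlex k hk).resolve_right fun h => absurd h.2 hnk.not_ge

lemma mem_stayPositive_iff {v : ℕ → ℝ} (hv : 0 ≤ v 0) (N : ℕ) :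
    v ∈ stayPositive N ↔
      ∃ n ≤ N, v ∈ positiveLadder n ∧ (fun k => v (n + k)) ∈ stayAboveStart (N - n) := by
  constructor
  · intro hpos
    obtain ⟨n, hn, hmin, hlast⟩ := exists_last_min v N
    refine ⟨n, hn, ⟨fun k hk => hmin k (hk.le.trans hn), ?_⟩, fun k h1 hk => ?_⟩
    · exact (Nat.eq_zero_or_pos n).imp_right fun h => hpos n h hn
    · exact hlast (n + k) (by omega) (by omega)
  · rintro ⟨n, -, ⟨hmin, hn⟩, habove⟩ k h1 hk
    have hvn : 0 ≤ v n := hn.elim (fun h => h ▸ hv) le_of_lt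
    rcases lt_trichotomy k n with hkn | rfl | hnk
    · exact (hn.resolve_left (by omega)).trans_le (hmin k hkn)
    · exact hn.resolve_left (by omega)
    · have hlt := habove (k - n) (by omega) (by omega)
      simp only [add_zero, Nat.add_sub_cancel' hnk.le] at hlt
      exact hvn.trans_lt hlt

lemma le_of_mem_positiveLadder_of_mem_stayAboveStart {v : ℕ → ℝ} {N m n : ℕ} (hn : n ≤ N)
    (hlad : v ∈ positiveLadder n) (habove : (fun k => v (m + k)) ∈ stayAboveStart (N - m)) :
    n ≤ m := by
  by_contra! hmn
  have hlt := habove (n - m) (by omega) (by omega)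
  simp only [add_zero, Nat.add_sub_cancel' hmn.le] at hlt
  exact (hlad.1 m hmn).not_gt hlt

/-- Decomposition of a positive path at the last time at which it is minimal. -/
lemma indicator_stayPositive {v : ℕ → ℝ} (hv : 0 ≤ v 0) (N : ℕ) :
    (stayPositive N).indicator (1 : (ℕ → ℝ) → ℝ≥0∞) v =
      ∑ n ∈ Finset.range (N + 1), (positiveLadder n).indicator 1 v *
        (stayAboveStart (N - n)).indicator 1 (fun k => v (n + k)) := by
  classical
  simp only [indicator_apply, Pi.one_apply, ite_mul, one_mul, zero_mul, ← ite_and]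
  by_cases hpos : v ∈ stayPositive N
  · obtain ⟨n, hn, hlad, habove⟩ := (mem_stayPositive_iff hv N).1 hpos
    rw [Finset.sum_eq_single_of_mem n (Finset.mem_range_succ_iff.2 hn), if_pos hpos,
      if_pos ⟨hlad, habove⟩]
    rintro m hm hmn
    refine if_neg fun ⟨hlad', habove'⟩ => hmn (le_antisymm ?_ ?_)
    · exact le_of_mem_positiveLadder_of_mem_stayAboveStart
        (Finset.mem_range_succ_iff.1 hm) hlad' habove
    · exact le_of_mem_positiveLadder_of_mem_stayAboveStart hn hlad habove'
  · rw [if_neg hpos, Finset.sum_eq_zero]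
    exact fun n hn => if_neg fun h =>
      hpos ((mem_stayPositive_iff hv N).2 ⟨n, Finset.mem_range_succ_iff.1 hn, h⟩)

end Excursions

lemma tsum_sum_range_sub (a : ℕ → ℕ → ℝ≥0∞) :
    ∑' N, ∑ n ∈ Finset.range (N + 1), a n (N - n) = ∑' n, ∑' m, a n m := by
  simp_rw [← Finset.Nat.sum_antidiagonal_eq_sum_range_succ a]
  rw [← ENNReal.tsum_prod, ← Equiv.tsum_eq Finset.HasAntidiagonal.sigmaAntidiagonalEquivProd,
    ENNReal.tsum_sigma']
  refine tsum_congr fun N => ?_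
  rw [← Finset.tsum_subtype]
  rfl

section Occupation

variable {Ω : Type*} [MeasurableSpace Ω] (P : Measure Ω) (X : ℕ → Ω → ℝ)

/-- The occupation measure of the walk started at `x`, a visit at time `n` being counted when the
path lies in `W n`. -/
def occupation (W : ℕ → Set (ℕ → ℝ)) (x : ℝ) : Measure ℝ :=
  Measure.sum fun n => (P.restrict (path X x ⁻¹' W n)).map fun ω => path X x ω n

/-- The Green measure of the walk killed when it enters `(-∞, 0]` at a time `≥ 1`. -/
def greenMeasure (x : ℝ) : Measure ℝ := occupation P X stayPositive x

/-- The occupation measure of the walk started at `x` before its first return to `(-∞, x]`. -/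
def climbMeasure (x : ℝ) : Measure ℝ := occupation P X stayAboveStart x

/-- The occupation measure, at its weak descending ladder epochs, of the walk started at `x` and
killed as in `greenMeasure`. -/
def ladderMeasure (x : ℝ) : Measure ℝ := occupation P X positiveLadder x

variable {P X}

namespace IsIIDSteps

variable (h : IsIIDSteps P X) {W : ℕ → Set (ℕ → ℝ)}
include h

lemma lintegral_occupation (hW : ∀ n, MeasurableSet (W n)) {ψ : ℝ → ℝ≥0∞} (hψ : Measurable ψ)
    (x : ℝ) :
    ∫⁻ y, ψ y ∂occupation P X W x =
      ∑' n, ∫⁻ ω, (W n).indicator 1 (path X x ω) * ψ (path X x ω n) ∂P := by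
  rw [occupation, lintegral_sum_measure]
  refine tsum_congr fun n => ?_
  have hWn : MeasurableSet (path X x ⁻¹' W n) := h.measurable_path x (hW n)
  rw [lintegral_map hψ (h.measurable_path_apply x n), ← lintegral_indicator hWn]
  refine lintegral_congr fun ω => ?_
  by_cases hω : path X x ω ∈ W n <;> simp [hω]

lemma occupation_apply (hW : ∀ n, MeasurableSet (W n)) {A : Set ℝ} (hA : MeasurableSet A)
    (x : ℝ) : occupation P X W x A = ∑' n, P {ω | path X x ω n ∈ A ∧ path X x ω ∈ W n} := by
  rw [occupation, Measure.sum_apply _ hA]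
  refine tsum_congr fun n => ?_
  rw [Measure.map_apply (h.measurable_path_apply x n) hA,
    Measure.restrict_apply' (h.measurable_path x (hW n))]
  rfl

lemma ae_occupation (hW : ∀ n, MeasurableSet (W n)) {x : ℝ} {A : Set ℝ} (hA : MeasurableSet A)
    (hWA : ∀ n, ∀ v ∈ W n, v 0 = x → v n ∈ A) : ∀ᵐ y ∂occupation P X W x, y ∈ A := by
  rw [ae_iff, ← compl_def, h.occupation_apply hW hA.compl]
  refine ENNReal.tsum_eq_zero.2 fun n => ?_
  convert! measure_empty (μ := P)
  exact eq_empty_of_forall_notMem fun ω ⟨hA', hω⟩ => hA' (hWA n _ hω (path_zero X x ω))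

lemma ae_ladderMeasure_mem_Icc {x : ℝ} (hx : 0 ≤ x) :
    ∀ᵐ z ∂ladderMeasure P X x, z ∈ Icc 0 x := by
  refine h.ae_occupation measurableSet_positiveLadder measurableSet_Icc ?_
  rintro n v ⟨hmin, hn⟩ rfl
  rcases Nat.eq_zero_or_pos n with rfl | hpos
  · exact ⟨hx, le_rfl⟩
  · exact ⟨(hn.resolve_left hpos.ne').le, hmin 0 hpos⟩

lemma climbMeasure_Iio (z t : ℝ) :
    climbMeasure P X z (Iio t) = climbMeasure P X 0 (Iio (t - z)) := by
  simp only [climbMeasure,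
    h.occupation_apply measurableSet_stayAboveStart measurableSet_Iio]
  refine tsum_congr fun n => congr_arg P (Set.ext fun ω => ?_)
  simp only [stayAboveStart, mem_Iio, mem_ofPred_eq, path_zero, path_eq_add X z ω,
    lt_sub_iff_add_lt', lt_add_iff_pos_right]

lemma ladderMeasure_univ (x : ℝ) :
    ladderMeasure P X x univ = ∑' n, P {ω | path X x ω ∈ positiveLadder n} := by
  simp only [ladderMeasure, h.occupation_apply measurableSet_positiveLadder .univ, mem_univ,
    true_and]

lemma weakDescRenewalMeasure_apply {B : Set ℝ} (hB : MeasurableSet B) :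
    weakDescRenewalMeasure P (walk X) B =
      ∑' n, P {ω | -walk X n ω ∈ B ∧ ∀ k < n, walk X n ω ≤ walk X k ω} := by
  rw [weakDescRenewalMeasure, Measure.sum_apply _ hB]
  refine tsum_congr fun n => ?_
  have hwalk : Measurable fun ω => -walk X n ω := by
    simpa only [path, zero_add] using (h.measurable_path_apply 0 n).fun_neg
  rw [Measure.map_apply hwalk hB, Measure.restrict_apply (hwalk hB)]
  rfl

lemma renewalFn_eq_ladderMeasure [IsProbabilityMeasure P] (x : ℝ) :
    renewalFn P (walk X) x = ladderMeasure P X x univ := by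
  have hle_start {n : ℕ} {ω : Ω} (hω : ∀ k < n, path X x ω n ≤ path X x ω k) :
      path X x ω n ≤ x := by
    rcases Nat.eq_zero_or_pos n with rfl | hn
    · exact (path_zero X x ω).le
    · simpa only [path_zero] using hω 0 hn
  rw [renewalFn, h.ladderMeasure_univ]
  split_ifs with hx
  · rw [h.weakDescRenewalMeasure_apply measurableSet_Ico]
    refine tsum_congr fun n => ?_
    refine congr_arg P (Set.ext fun ω => ⟨fun ⟨hmem, hmin⟩ => ⟨fun k hk => ?_, ?_⟩,
      fun ⟨hmin, hn⟩ => ⟨⟨?_, ?_⟩, fun k hk => ?_⟩⟩)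
    · exact add_le_add_right (hmin k hk) x
    · exact .inr (neg_lt_iff_pos_add.1 hmem.2)
    · linarith [hle_start hmin, show path X x ω n = x + walk X n ω from rfl]
    · refine neg_lt_iff_pos_add.2 (hn.elim (fun h0 => ?_) id)
      simpa only [h0, walk, Finset.range_zero, Finset.sum_empty, add_zero] using hx
    · exact le_of_add_le_add_left (hmin k hk)
  · rw [tsum_eq_single 0]
    · simp [positiveLadder]
    · refine fun n hn => measure_mono_null (fun ω ⟨hmin, hpos⟩ => ?_) measure_empty
      exact hx ((hpos.resolve_left hn).trans_le (hle_start hmin))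

lemma monotone_renewalFn [IsProbabilityMeasure P] : Monotone (renewalFn P (walk X)) := by
  intro x y hxy
  simp only [h.renewalFn_eq_ladderMeasure, h.ladderMeasure_univ]
  refine ENNReal.tsum_le_tsum fun n => measure_mono fun ω ⟨hmin, hpos⟩ => ⟨fun k hk => ?_, ?_⟩
  · exact add_le_add_right (le_of_add_le_add_left (hmin k hk)) y
  · exact hpos.imp_right fun hn => hn.trans_le (add_le_add_left hxy _)

lemma measurable_renewalFn [IsProbabilityMeasure P] : Measurable (renewalFn P (walk X)) :=
  h.monotone_renewalFn.measurable

lemma measurable_lintegral_occupation [IsProbabilityMeasure P] (hW : ∀ n, MeasurableSet (W n))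
    {ψ : ℝ → ℝ≥0∞} (hψ : Measurable ψ) : Measurable fun z => ∫⁻ y, ψ y ∂occupation P X W z := by
  simp only [h.lintegral_occupation hW hψ]
  exact .tsum fun m => h.measurable_lintegral_path
    ((measurable_one.indicator (hW m)).mul (hψ.comp (measurable_pi_apply m)))

lemma tsum_lintegral_mul_occupation [IsProbabilityMeasure P] (hW : ∀ n, MeasurableSet (W n))
    {ψ : ℝ → ℝ≥0∞} (hψ : Measurable ψ) {n : ℕ} {f : (ℕ → ℝ) → ℝ≥0∞} (hf : Measurable f)
    (hfn : DependsOn f (Iic n)) (x : ℝ) :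
    ∑' m, ∫⁻ ω, f (path X x ω) *
        ((W m).indicator 1 (fun k => path X x ω (n + k)) * ψ (path X x ω (n + m))) ∂P =
      ∫⁻ ω, f (path X x ω) * ∫⁻ y, ψ y ∂occupation P X W (path X x ω n) ∂P := by
  set visit : ℕ → (ℕ → ℝ) → ℝ≥0∞ := fun m v => (W m).indicator 1 v * ψ (v m)
  have hvisit (m : ℕ) : Measurable (visit m) :=
    (measurable_one.indicator (hW m)).mul (hψ.comp (measurable_pi_apply m))
  calc ∑' m, ∫⁻ ω, f (path X x ω) * visit m (fun k => path X x ω (n + k)) ∂P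
      = ∑' m, ∫⁻ ω, f (path X x ω) * ∫⁻ ω', visit m (path X (path X x ω n) ω') ∂P ∂P :=
        tsum_congr fun m => h.lintegral_markov hf hfn (hvisit m) x
    _ = ∫⁻ ω, ∑' m, f (path X x ω) * ∫⁻ ω', visit m (path X (path X x ω n) ω') ∂P ∂P :=
        (lintegral_tsum fun m => ((hf.comp (h.measurable_path x)).mul
          ((h.measurable_lintegral_path (hvisit m)).comp
            (h.measurable_path_apply x n))).aemeasurable).symm
    _ = ∫⁻ ω, f (path X x ω) * ∫⁻ y, ψ y ∂occupation P X W (path X x ω n) ∂P := by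
        simp only [ENNReal.tsum_mul_left, h.lintegral_occupation hW hψ, visit]

/-- The walk killed on entering `(-∞, 0]` descends along its ladder epochs to its last minimum, and
stays above it from then on. -/
lemma lintegral_greenMeasure [IsProbabilityMeasure P] {ψ : ℝ → ℝ≥0∞} (hψ : Measurable ψ) {x : ℝ}
    (hx : 0 ≤ x) :
    ∫⁻ y, ψ y ∂greenMeasure P X x = ∫⁻ z, ∫⁻ y, ψ y ∂climbMeasure P X z ∂ladderMeasure P X x := by
  set split : ℕ → ℕ → (ℕ → ℝ) → ℝ≥0∞ := fun n m v => (positiveLadder n).indicator 1 v *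
    ((stayAboveStart m).indicator 1 (fun k => v (n + k)) * ψ (v (n + m)))
  have hladder (n : ℕ) : Measurable ((positiveLadder n).indicator (1 : (ℕ → ℝ) → ℝ≥0∞)) :=
    measurable_one.indicator (measurableSet_positiveLadder n)
  have hclimb (m : ℕ) : Measurable ((stayAboveStart m).indicator (1 : (ℕ → ℝ) → ℝ≥0∞)) :=
    measurable_one.indicator (measurableSet_stayAboveStart m)
  have hpath := h.measurable_path x
  have hsplit (ω : Ω) (N : ℕ) : (stayPositive N).indicator 1 (path X x ω) * ψ (path X x ω N) =
      ∑ n ∈ Finset.range (N + 1), split n (N - n) (path X x ω) := by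
    rw [indicator_stayPositive (hx.trans_eq (path_zero X x ω).symm), Finset.sum_mul]
    refine Finset.sum_congr rfl fun n hn => ?_
    simp only [split, mul_assoc, Nat.add_sub_cancel' (Finset.mem_range_succ_iff.1 hn)]
  calc ∫⁻ y, ψ y ∂greenMeasure P X x
      = ∑' N, ∑ n ∈ Finset.range (N + 1), ∫⁻ ω, split n (N - n) (path X x ω) ∂P := by
        rw [greenMeasure, h.lintegral_occupation measurableSet_stayPositive hψ]
        refine tsum_congr fun N => ?_
        simp only [hsplit]
        exact lintegral_finsetSum _ fun n _ => by fun_prop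
    _ = ∑' n, ∑' m, ∫⁻ ω, split n m (path X x ω) ∂P :=
        tsum_sum_range_sub fun n m => ∫⁻ ω, split n m (path X x ω) ∂P
    _ = ∑' n, ∫⁻ ω, (positiveLadder n).indicator 1 (path X x ω) *
          ∫⁻ y, ψ y ∂climbMeasure P X (path X x ω n) ∂P :=
        tsum_congr fun n => h.tsum_lintegral_mul_occupation measurableSet_stayAboveStart hψ
          (hladder n) (dependsOn_indicator (dependsOn_positiveLadder n)) x
    _ = ∫⁻ z, ∫⁻ y, ψ y ∂climbMeasure P X z ∂ladderMeasure P X x :=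
        (h.lintegral_occupation measurableSet_positiveLadder
          (h.measurable_lintegral_occupation measurableSet_stayAboveStart hψ) x).symm

lemma greenMeasure_apply [IsProbabilityMeasure P] {A : Set ℝ} (hA : MeasurableSet A) {x : ℝ}
    (hx : 0 ≤ x) : greenMeasure P X x A = ∫⁻ z, climbMeasure P X z A ∂ladderMeasure P X x := by
  simp only [← lintegral_indicator_one hA,
    h.lintegral_greenMeasure (measurable_one.indicator hA) hx]

lemma greenMeasure_le [IsProbabilityMeasure P] {A : Set ℝ} (hA : MeasurableSet A) {b : ℝ≥0∞}
    {x : ℝ} (hx : 0 ≤ x) (hb : ∀ z ∈ Icc 0 x, climbMeasure P X z A ≤ b) :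
    greenMeasure P X x A ≤ b * renewalFn P (walk X) x := by
  rw [h.greenMeasure_apply hA hx, h.renewalFn_eq_ladderMeasure, ← lintegral_const]
  exact lintegral_mono_ae ((h.ae_ladderMeasure_mem_Icc hx).mono hb)

lemma le_greenMeasure [IsProbabilityMeasure P] {A : Set ℝ} (hA : MeasurableSet A) {b : ℝ≥0∞}
    {x : ℝ} (hx : 0 ≤ x) (hb : ∀ z ∈ Icc 0 x, b ≤ climbMeasure P X z A) :
    b * renewalFn P (walk X) x ≤ greenMeasure P X x A := by
  rw [h.greenMeasure_apply hA hx, h.renewalFn_eq_ladderMeasure, ← lintegral_const]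
  exact lintegral_mono_ae ((h.ae_ladderMeasure_mem_Icc hx).mono hb)

end IsIIDSteps

end Occupation

section LinearGrowth

/-- `f` is bounded above and below by multiples of the identity on `[1, ∞)`. -/
def HasLinearGrowth (f : ℝ → ℝ≥0∞) : Prop :=
  ∃ c C : ℝ≥0∞, c ≠ 0 ∧ C ≠ ∞ ∧
    ∀ t, 1 ≤ t → c * ENNReal.ofReal t ≤ f t ∧ f t ≤ C * ENNReal.ofReal t

lemma HasLinearGrowth.of_sq_le_mul {f g : ℝ → ℝ≥0∞} {A C D : ℝ≥0∞} (hA : A ≠ ∞) (hC : C ≠ ∞)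
    (hD : D ≠ ∞) (hf : ∀ t, 1 ≤ t → f t ≤ C * ENNReal.ofReal t)
    (hg : ∀ t, 1 ≤ t → g t ≤ D * ENNReal.ofReal t)
    (hfg : ∀ t, 1 ≤ t → ENNReal.ofReal t ^ 2 ≤ A * (f t * g t)) : HasLinearGrowth f := by
  refine ⟨(A * D)⁻¹, C, ENNReal.inv_ne_zero.2 (ENNReal.mul_ne_top hA hD), hC, fun t ht =>
    ⟨?_, hf t ht⟩⟩
  rw [mul_comm, ← div_eq_mul_inv]
  refine ENNReal.div_le_of_le_mul ?_
  have ht0 : ENNReal.ofReal t ≠ 0 := (ENNReal.ofReal_pos.2 (by linarith)).ne'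
  refine (ENNReal.mul_le_mul_iff_left ht0 ENNReal.ofReal_ne_top).1 ?_
  calc ENNReal.ofReal t * ENNReal.ofReal t = ENNReal.ofReal t ^ 2 := (sq _).symm
    _ ≤ A * (f t * (D * ENNReal.ofReal t)) := (hfg t ht).trans (by gcongr; exact hg t ht)
    _ = f t * (A * D) * ENNReal.ofReal t := by ring

lemma measure_Ico_zero_le {μ : Measure ℝ} {δ : ℝ} (hδ : 0 < δ) {B : ℝ≥0∞}
    (hB : ∀ s, μ (Ico s (s + δ)) ≤ B) {t : ℝ} (ht : 1 ≤ t) :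
    μ (Ico 0 t) ≤ ENNReal.ofReal (δ⁻¹ + 1) * B * ENNReal.ofReal t := by
  have hcover : Ico 0 t ⊆ ⋃ i ∈ Finset.range ⌈t / δ⌉₊, Ico (i * δ) (i * δ + δ) := fun y hy => by
    have hfloor := Nat.floor_le (div_nonneg hy.1 hδ.le)
    refine mem_biUnion (x := ⌊y / δ⌋₊) (Finset.mem_coe.2 (Finset.mem_range.2 ?_)) ⟨?_, ?_⟩
    · exact_mod_cast hfloor.trans_lt ((div_lt_div_of_pos_right hy.2 hδ).trans_le (Nat.le_ceil _))
    · exact (le_div_iff₀ hδ).1 hfloor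
    · rw [← add_one_mul]
      exact (div_lt_iff₀ hδ).1 (Nat.lt_floor_add_one _)
  have hceil : (⌈t / δ⌉₊ : ℝ) ≤ (δ⁻¹ + 1) * t := by
    have := (Nat.ceil_lt_add_one (div_nonneg (by linarith : 0 ≤ t) hδ.le)).le
    linarith [div_eq_inv_mul t δ]
  calc μ (Ico 0 t) ≤ ∑ i ∈ Finset.range ⌈t / δ⌉₊, μ (Ico (i * δ) (i * δ + δ)) :=
        (measure_mono hcover).trans (measure_biUnion_finset_le _ _)
    _ ≤ ∑ _i ∈ Finset.range ⌈t / δ⌉₊, B := Finset.sum_le_sum fun i _ => hB _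
    _ = ⌈t / δ⌉₊ * B := by simp
    _ ≤ ENNReal.ofReal (δ⁻¹ + 1) * B * ENNReal.ofReal t := by
        rw [mul_right_comm, ← ENNReal.ofReal_mul (by positivity), ← ENNReal.ofReal_natCast]
        gcongr

lemma exists_measure_le_neg_ne_zero {Ω : Type*} [MeasurableSpace Ω] {P : Measure Ω} {Y : Ω → ℝ}
    (hY : Integrable Y P) (hmean : ∫ ω, Y ω ∂P = 0) (hvar : variance Y P ≠ 0) :
    ∃ δ > 0, P {ω | Y ω ≤ -δ} ≠ 0 := by
  by_contra! hzero
  have hnonneg : ∀ᵐ ω ∂P, 0 ≤ Y ω := by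
    have hgt (n : ℕ) : ∀ᵐ ω ∂P, -(1 / ((n : ℝ) + 1)) < Y ω := by
      simpa only [ae_iff, not_lt] using hzero _ Nat.one_div_pos_of_nat
    filter_upwards [ae_all_iff.2 hgt] with ω hω
    refine le_of_forall_pos_lt_add fun ε hε => ?_
    obtain ⟨n, hn⟩ := exists_nat_one_div_lt hε
    linarith [hω n]
  refine hvar ?_
  rw [variance_congr ((integral_eq_zero_iff_of_nonneg_ae hnonneg hY).1 hmean), variance_zero]

variable {Ω : Type*} [MeasurableSpace Ω] {P : Measure Ω} {X : ℕ → Ω → ℝ}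

/-- The steps are independent and identically distributed, centred, with a finite positive
variance. -/
structure IsCenteredSteps (P : Measure Ω) (X : ℕ → Ω → ℝ) : Prop extends IsIIDSteps P X where
  memLp : MemLp (X 0) 2 P
  integral_eq_zero : ∫ ω, X 0 ω ∂P = 0
  variance_pos : 0 < variance (X 0) P

lemma IsCenteredSteps.neg (h : IsCenteredSteps P X) : IsCenteredSteps P (-X) where
  measurable n := (h.measurable n).neg
  indep := h.indep.comp (fun _ x => -x) fun _ => measurable_neg
  ident n := (h.ident n).comp measurable_neg
  memLp := h.memLp.neg
  integral_eq_zero := by simp [integral_neg, h.integral_eq_zero]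
  variance_pos := by simpa only [Pi.neg_apply, variance_neg] using h.variance_pos

variable [IsProbabilityMeasure P]

lemma IsIIDSteps.lintegral_path_mul_step (h : IsIIDSteps P X) {n : ℕ} {f : (ℕ → ℝ) → ℝ≥0∞}
    (hf : Measurable f) (hfn : DependsOn f (Iic n)) {ψ : ℝ → ℝ → ℝ≥0∞}
    (hψ : Measurable (Function.uncurry ψ)) (x : ℝ) :
    ∫⁻ ω, f (path X x ω) * ψ (path X x ω n) (X n ω) ∂P =
      ∫⁻ ω, f (path X x ω) * ∫⁻ ω', ψ (path X x ω n) (X 0 ω') ∂P ∂P := by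
  have hpair : Measurable fun v : ℕ → ℝ => (v 0, v 1 - v 0) := by fun_prop
  have hg : Measurable fun v : ℕ → ℝ => ψ (v 0) (v 1 - v 0) := hψ.comp hpair
  have hone (y : ℝ) (ω : Ω) : path X y ω 1 = y + X 0 ω := by rw [path_succ, path_zero]
  simpa only [add_zero, path_zero, path_succ X x, hone, add_sub_cancel_left] using
    h.lintegral_markov hf hfn hg x

lemma IsIIDSteps.measure_path_mem_inter_step (h : IsIIDSteps P X) {n : ℕ} {W : Set (ℕ → ℝ)}
    (hW : MeasurableSet W) (hdep : DependsOn (· ∈ W) (Iic n)) {A : Set ℝ} (hA : MeasurableSet A)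
    (x : ℝ) : P {ω | path X x ω ∈ W ∧ X n ω ∈ A} = P {ω | path X x ω ∈ W} * P {ω | X 0 ω ∈ A} := by
  classical
  have hstep := h.lintegral_path_mul_step (measurable_one.indicator hW) (dependsOn_indicator hdep)
    (ψ := fun _ y => A.indicator 1 y) ((measurable_one.indicator hA).comp measurable_snd) x
  have hX : ∫⁻ ω, A.indicator 1 (X 0 ω) ∂P = P {ω | X 0 ω ∈ A} :=
    lintegral_indicator_one (h.measurable 0 hA)
  have hpath : ∫⁻ ω, W.indicator 1 (path X x ω) ∂P = P {ω | path X x ω ∈ W} :=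
    lintegral_indicator_one (h.measurable_path x hW)
  rw [hX, lintegral_mul_const' _ _ (measure_ne_top P _), hpath] at hstep
  refine (lintegral_indicator_one ((h.measurable_path x hW).inter (h.measurable n hA))).symm.trans
    ((lintegral_congr fun ω => ?_).trans hstep)
  simp only [indicator_apply, mem_inter_iff, mem_preimage, Pi.one_apply]
  split_ifs <;> simp_all

/-- A step `≤ -δ` from a ladder height in `[s, s + δ)` leads out of this interval for good, so this
can happen at most once. -/
lemma IsIIDSteps.weakDescRenewalMeasure_Ico_mul_le (h : IsIIDSteps P X) (s δ : ℝ) :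
    weakDescRenewalMeasure P (walk X) (Ico s (s + δ)) * P {ω | X 0 ω ≤ -δ} ≤ 1 := by
  set ladderIn : ℕ → Set (ℕ → ℝ) := fun n =>
    {v | -v n ∈ Ico s (s + δ) ∧ v ∈ weakDescLadderEvent (fun k v => v k) n}
  have hmeas (n : ℕ) : MeasurableSet (ladderIn n) :=
    ((measurable_pi_apply n).neg measurableSet_Ico).inter
      (measurableSet_weakDescLadderEvent measurable_pi_apply n)
  have hdep (n : ℕ) : DependsOn (· ∈ ladderIn n) (Iic n) := fun _ _ huv => propext <|
    and_congr (by rw [huv n self_mem_Iic]) (dependsOn_weakDescLadderEvent n huv).to_iff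
  set leave : ℕ → Set Ω := fun n => {ω | path X 0 ω ∈ ladderIn n ∧ X n ω ≤ -δ}
  have hleave (n : ℕ) : MeasurableSet (leave n) :=
    (h.measurable_path 0 (hmeas n)).inter (measurableSet_le (h.measurable n) measurable_const)
  have hindep (n : ℕ) :
      P (leave n) = P {ω | path X 0 ω ∈ ladderIn n} * P {ω | X 0 ω ≤ -δ} :=
    h.measure_path_mem_inter_step (hmeas n) (hdep n) measurableSet_Iic 0
  have hdisj : Pairwise (Function.onFun Disjoint leave) := by
    refine (pairwise_disjoint_on leave).2 fun m n hmn => disjoint_left.2 ?_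
    rintro ω ⟨⟨hm, -⟩, hX⟩ ⟨⟨hn, hmin⟩, -⟩
    have hstep := path_succ X 0 ω m
    have hle : path X 0 ω n ≤ path X 0 ω (m + 1) :=
      (Nat.succ_le_of_lt hmn).eq_or_lt.elim (fun he => he ▸ le_rfl) (hmin _)
    linarith [hm.1, hn.2]
  calc weakDescRenewalMeasure P (walk X) (Ico s (s + δ)) * P {ω | X 0 ω ≤ -δ}
      = ∑' n, P (leave n) := by
        simp only [h.weakDescRenewalMeasure_apply measurableSet_Ico, ← ENNReal.tsum_mul_right,
          hindep, ladderIn, weakDescLadderEvent, path, zero_add, mem_ofPred_eq]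
    _ = P (⋃ n, leave n) := (measure_iUnion hdisj hleave).symm
    _ ≤ 1 := prob_le_one

lemma IsIIDSteps.climbMeasure_Iio_le_renewalFn_neg (h : IsIIDSteps P X)
    (hneg : IsIIDSteps P (-X)) (t : ℝ) :
    climbMeasure P X 0 (Iio t) ≤ renewalFn P (walk (-X)) t := by
  rw [climbMeasure, h.occupation_apply measurableSet_stayAboveStart measurableSet_Iio,
    hneg.renewalFn_eq_ladderMeasure, hneg.ladderMeasure_univ]
  refine ENNReal.tsum_le_tsum fun n => ?_
  set climbBelow : Set (ℕ → ℝ) := {v | v n ∈ Iio t ∧ v ∈ stayAboveStart n}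
  have hmeas : MeasurableSet climbBelow :=
    (measurable_pi_apply n measurableSet_Iio).inter (measurableSet_stayAboveStart n)
  have hdep : DependsOn (· ∈ climbBelow) (Iic n) := fun u v huv =>
    propext (and_congr (by rw [huv n self_mem_Iic]) (dependsOn_stayAboveStart n huv).to_iff)
  have hrev : Measurable fun ω k => path X 0 ω n - path X 0 ω (n - k) :=
    measurable_pi_iff.2 fun k => (h.measurable_path_apply 0 n).sub (h.measurable_path_apply 0 _)
  calc P {ω | path X 0 ω ∈ climbBelow}
      = P {ω | (fun k => path X 0 ω n - path X 0 ω (n - k)) ∈ climbBelow} := by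
        have := h.lintegral_reverse n (measurable_one.indicator hmeas) (dependsOn_indicator hdep)
        exact (lintegral_indicator_one (h.measurable_path 0 hmeas)).symm.trans
          (this.symm.trans (lintegral_indicator_one (hrev hmeas)))
    _ ≤ P {ω | path (-X) t ω ∈ positiveLadder n} := measure_mono fun ω ⟨hlt, habove⟩ => by
        have hneg_path (k : ℕ) : path (-X) t ω k = t - path X 0 ω k := by
          simp [path, walk, sub_eq_add_neg]
        simp only [mem_Iio, tsub_self, path_zero, sub_zero] at hlt
        refine ⟨fun k hk => ?_, .inr (by simpa only [hneg_path, sub_pos] using hlt)⟩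
        have := habove (n - k) (by omega) (by omega)
        simp only [Nat.sub_sub_self hk.le, tsub_zero, sub_self, sub_pos] at this
        simpa only [hneg_path, sub_le_sub_iff_left] using this.le

/-- Paths that have stayed in `(-s, s)` up to the time `n`. -/
def confined (s : ℝ) (n : ℕ) : Set (ℕ → ℝ) :=
  {v | ∀ k ≤ n, |v k| < s}

lemma measurableSet_confined (s : ℝ) (n : ℕ) : MeasurableSet (confined s n) := by
  simp only [confined, ofPred_forall]
  exact .iInter fun k => .iInter fun _ =>
    measurableSet_lt (measurable_pi_apply k).abs measurable_const

lemma dependsOn_confined (s : ℝ) (n : ℕ) : DependsOn (· ∈ confined s n) (Iic n) := fun _ _ huv =>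
  propext <| forall₂_congr fun k hk => by rw [huv k hk]

lemma lintegral_add_sq {Y : Ω → ℝ} (hY : MemLp Y 2 P) (hmean : ∫ ω, Y ω ∂P = 0) (c : ℝ) :
    ∫⁻ ω, ENNReal.ofReal ((c + Y ω) ^ 2) ∂P =
      ENNReal.ofReal (c ^ 2) + ENNReal.ofReal (variance Y P) := by
  have hcY : MemLp (fun ω => c + Y ω) 2 P := (memLp_const c).add hY
  have hint : Integrable Y P := hY.integrable (by norm_num)
  have hmean' : ∫ ω, (c + Y ω) ∂P = c := by
    rw [integral_add (integrable_const c) hint, hmean]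
    simp
  rw [← ofReal_integral_eq_lintegral_ofReal hcY.integrable_sq (ae_of_all _ fun ω => sq_nonneg _),
    ← ENNReal.ofReal_add (sq_nonneg c) (variance_nonneg Y P)]
  have hvar := variance_eq_sub hcY
  rw [hmean', variance_const_add hY.aestronglyMeasurable] at hvar
  congr 1
  linarith [show ∫ ω, (c + Y ω) ^ 2 ∂P = P[(fun ω => c + Y ω) ^ 2] from rfl]

lemma indicator_confined_succ_mul_sq_add_le {s : ℝ} (hs : 0 ≤ s) (n : ℕ) (v : ℕ → ℝ) :
    (confined s (n + 1)).indicator 1 v * ENNReal.ofReal (v (n + 1) ^ 2) +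
        ENNReal.ofReal (s ^ 2) * (confined s n).indicator 1 v ≤
      (confined s n).indicator 1 v * ENNReal.ofReal (v (n + 1) ^ 2) +
        ENNReal.ofReal (s ^ 2) * (confined s (n + 1)).indicator 1 v := by
  by_cases hn : v ∈ confined s n
  · by_cases hsucc : v ∈ confined s (n + 1)
    · simp [hn, hsucc]
    · have hexit : s ≤ |v (n + 1)| := by
        by_contra! hlt
        exact hsucc fun k hk =>
          (Nat.le_or_eq_of_le_succ hk).elim (hn k) fun he => he ▸ hlt
      have hsq : s ^ 2 ≤ v (n + 1) ^ 2 := sq_le_sq.2 ((abs_of_nonneg hs).trans_le hexit)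
      simpa [hn, hsucc] using ENNReal.ofReal_le_ofReal hsq
  · have hsucc : v ∉ confined s (n + 1) := fun hv => hn fun k hk => hv k (hk.trans n.le_succ)
    simp [hn, hsucc]

namespace IsCenteredSteps

lemma lintegral_mul_sq_succ (h : IsCenteredSteps P X) {n : ℕ} {f : (ℕ → ℝ) → ℝ≥0∞}
    (hf : Measurable f) (hfn : DependsOn f (Iic n)) (x : ℝ) :
    ∫⁻ ω, f (path X x ω) * ENNReal.ofReal (path X x ω (n + 1) ^ 2) ∂P =
      ∫⁻ ω, f (path X x ω) * ENNReal.ofReal (path X x ω n ^ 2) ∂P +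
        ENNReal.ofReal (variance (X 0) P) * ∫⁻ ω, f (path X x ω) ∂P := by
  have hstep := h.lintegral_path_mul_step hf hfn
    (ψ := fun a y => ENNReal.ofReal ((a + y) ^ 2)) (by fun_prop) x
  have hfpath : Measurable fun ω => f (path X x ω) := hf.comp (h.measurable_path x)
  simp only [lintegral_add_sq h.memLp h.integral_eq_zero, mul_add, ← path_succ] at hstep
  rw [hstep, lintegral_add_right _ (hfpath.mul_const _), lintegral_mul_const _ hfpath, mul_comm _
    (∫⁻ ω, f (path X x ω) ∂P)]

/-- The second moment of the walk grows by the variance at each step before the exit from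
`(-s, s)`, and it is at least `s ^ 2` after the exit. -/
lemma sq_le_sum_measure_confined (h : IsCenteredSteps P X) {s : ℝ} (hs : 0 < s) (n : ℕ) :
    ENNReal.ofReal (s ^ 2) ≤
      ENNReal.ofReal (variance (X 0) P) * ∑ k ∈ Finset.range n, P {ω | path X 0 ω ∈ confined s k} +
        ENNReal.ofReal (s ^ 2) * P {ω | path X 0 ω ∈ confined s n} := by
  set σ2 := ENNReal.ofReal (variance (X 0) P)
  set s2 := ENNReal.ofReal (s ^ 2)
  set a : ℕ → ℝ≥0∞ := fun n => P {ω | path X 0 ω ∈ confined s n}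
  have ha (n : ℕ) : ∫⁻ ω, (confined s n).indicator 1 (path X 0 ω) ∂P = a n :=
    lintegral_indicator_one (h.measurable_path 0 (measurableSet_confined s n))
  have hconf (n : ℕ) : Measurable ((confined s n).indicator (1 : (ℕ → ℝ) → ℝ≥0∞)) :=
    measurable_one.indicator (measurableSet_confined s n)
  set u : ℕ → ℝ≥0∞ := fun n =>
    ∫⁻ ω, (confined s n).indicator 1 (path X 0 ω) * ENNReal.ofReal (path X 0 ω n ^ 2) ∂P
  have hstep (n : ℕ) : u (n + 1) + s2 * a n ≤ u n + σ2 * a n + s2 * a (n + 1) := by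
    have hmono := lintegral_mono (μ := P) fun ω =>
      indicator_confined_succ_mul_sq_add_le hs.le n (path X 0 ω)
    have hmeas (n : ℕ) : Measurable fun ω =>
        s2 * (confined s n).indicator (1 : (ℕ → ℝ) → ℝ≥0∞) (path X 0 ω) :=
      ((hconf n).comp (h.measurable_path 0)).const_mul _
    rwa [lintegral_add_right _ (hmeas n), lintegral_add_right _ (hmeas (n + 1)),
      lintegral_const_mul' _ _ ENNReal.ofReal_ne_top,
      lintegral_const_mul' _ _ ENNReal.ofReal_ne_top,
      h.lintegral_mul_sq_succ (hconf n) (dependsOn_indicator (dependsOn_confined s n)) 0,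
      ha, ha] at hmono
  suffices s2 + u n ≤ σ2 * ∑ k ∈ Finset.range n, a k + s2 * a n from le_self_add.trans this
  induction n with
  | zero => simp [u, a, confined, hs]
  | succ n ih =>
    have hfin : s2 * a n ≠ ∞ := ENNReal.mul_ne_top ENNReal.ofReal_ne_top (measure_ne_top P _)
    refine (ENNReal.add_le_add_iff_right hfin).1 ?_
    calc s2 + u (n + 1) + s2 * a n = s2 + (u (n + 1) + s2 * a n) := add_assoc _ _ _
      _ ≤ s2 + (u n + σ2 * a n + s2 * a (n + 1)) := add_le_add_right (hstep n) s2
      _ = s2 + u n + (σ2 * a n + s2 * a (n + 1)) := by ring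
      _ ≤ σ2 * ∑ k ∈ Finset.range n, a k + s2 * a n + (σ2 * a n + s2 * a (n + 1)) := by gcongr
      _ = σ2 * ∑ k ∈ Finset.range (n + 1), a k + s2 * a (n + 1) + s2 * a n := by
          rw [Finset.sum_range_succ]
          ring

lemma sq_le_tsum_measure_confined (h : IsCenteredSteps P X) {s : ℝ} (hs : 0 < s) :
    ENNReal.ofReal (s ^ 2) ≤
      ENNReal.ofReal (variance (X 0) P) * ∑' n, P {ω | path X 0 ω ∈ confined s n} := by
  by_cases htop : ∑' n, P {ω | path X 0 ω ∈ confined s n} = ∞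
  · rw [htop, ENNReal.mul_top (ENNReal.ofReal_pos.2 h.variance_pos).ne']
    exact le_top
  · have hlim := ENNReal.Tendsto.const_mul (a := ENNReal.ofReal (s ^ 2))
      (ENNReal.tendsto_atTop_zero_of_tsum_ne_top htop) (.inr ENNReal.ofReal_ne_top)
    refine ge_of_tendsto' (x := Filter.atTop)
      (by simpa only [mul_zero, add_zero] using hlim.const_add _) fun n =>
      (h.sq_le_sum_measure_confined hs n).trans ?_
    gcongr
    exact ENNReal.sum_le_tsum _

lemma sq_le_climbMeasure_mul_renewalFn (h : IsCenteredSteps P X) {s : ℝ} (hs : 0 < s) :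
    ENNReal.ofReal (s ^ 2) ≤ ENNReal.ofReal (variance (X 0) P) *
      (climbMeasure P X 0 (Iio (2 * s)) * renewalFn P (walk X) s) := by
  calc ENNReal.ofReal (s ^ 2)
      ≤ ENNReal.ofReal (variance (X 0) P) * ∑' n, P {ω | path X 0 ω ∈ confined s n} :=
        h.sq_le_tsum_measure_confined hs
    _ ≤ ENNReal.ofReal (variance (X 0) P) * greenMeasure P X s (Iio (2 * s)) := by
        rw [greenMeasure, h.occupation_apply measurableSet_stayPositive measurableSet_Iio]
        gcongr with n ω
        intro hω
        refine ⟨?_, fun k _ hk => ?_⟩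
        · rw [mem_Iio, path_eq_add]
          linarith [(abs_lt.1 (hω n le_rfl)).2]
        · rw [path_eq_add]
          linarith [(abs_lt.1 (hω k hk)).1]
    _ ≤ _ := by
        gcongr
        refine h.greenMeasure_le measurableSet_Iio hs.le fun z hz => ?_
        rw [h.climbMeasure_Iio]
        exact measure_mono (Iio_subset_Iio (by linarith [hz.1]))

lemma exists_renewalFn_le (h : IsCenteredSteps P X) :
    ∃ C : ℝ≥0∞, C ≠ ∞ ∧ ∀ t, 1 ≤ t → renewalFn P (walk X) t ≤ C * ENNReal.ofReal t := by
  obtain ⟨δ, hδ, hp⟩ := exists_measure_le_neg_ne_zero (h.memLp.integrable (by norm_num))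
    h.integral_eq_zero h.variance_pos.ne'
  refine ⟨ENNReal.ofReal (δ⁻¹ + 1) * (P {ω | X 0 ω ≤ -δ})⁻¹,
    ENNReal.mul_ne_top ENNReal.ofReal_ne_top (ENNReal.inv_ne_top.2 hp), fun t ht => ?_⟩
  rw [renewalFn, if_pos (by linarith)]
  exact measure_Ico_zero_le hδ
    (fun s => ENNReal.le_inv_iff_mul_le.2 (h.weakDescRenewalMeasure_Ico_mul_le s δ)) ht

lemma exists_climbMeasure_Iio_le (h : IsCenteredSteps P X) :
    ∃ C : ℝ≥0∞, C ≠ ∞ ∧ ∀ t, 1 ≤ t → climbMeasure P X 0 (Iio t) ≤ C * ENNReal.ofReal t := by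
  obtain ⟨C, hC, hle⟩ := h.neg.exists_renewalFn_le
  exact ⟨C, hC, fun t ht =>
    (h.climbMeasure_Iio_le_renewalFn_neg h.neg.toIsIIDSteps t).trans (hle t ht)⟩

lemma sq_ofReal_le_climbMeasure_mul_renewalFn (h : IsCenteredSteps P X) {t : ℝ} (ht : 0 < t) :
    ENNReal.ofReal t ^ 2 ≤ 4 * ENNReal.ofReal (variance (X 0) P) *
      (climbMeasure P X 0 (Iio t) * renewalFn P (walk X) t) := by
  have hmono := h.monotone_renewalFn (half_le_self ht.le)
  have hhalf := h.sq_le_climbMeasure_mul_renewalFn (half_pos ht)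
  rw [mul_div_cancel₀ t two_ne_zero] at hhalf
  calc ENNReal.ofReal t ^ 2 = 4 * ENNReal.ofReal ((t / 2) ^ 2) := by
        rw [← ENNReal.ofReal_pow ht.le, show (4 : ℝ≥0∞) = ENNReal.ofReal 4 by norm_num,
          ← ENNReal.ofReal_mul (by norm_num)]
        ring_nf
    _ ≤ 4 * (ENNReal.ofReal (variance (X 0) P) *
          (climbMeasure P X 0 (Iio t) * renewalFn P (walk X) t)) := by
        gcongr
        exact hhalf.trans (by gcongr)
    _ = _ := (mul_assoc _ _ _).symm

theorem hasLinearGrowth_renewalFn (h : IsCenteredSteps P X) :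
    HasLinearGrowth (renewalFn P (walk X)) := by
  obtain ⟨C, hC, hle⟩ := h.exists_renewalFn_le
  obtain ⟨D, hD, hle'⟩ := h.exists_climbMeasure_Iio_le
  refine .of_sq_le_mul (A := 4 * ENNReal.ofReal (variance (X 0) P)) (by finiteness) hC hD hle hle'
    fun t ht => ?_
  rw [mul_comm (renewalFn _ _ _)]
  exact h.sq_ofReal_le_climbMeasure_mul_renewalFn (by linarith)

theorem hasLinearGrowth_climbMeasure (h : IsCenteredSteps P X) :
    HasLinearGrowth fun t => climbMeasure P X 0 (Iio t) := by
  obtain ⟨C, hC, hle⟩ := h.exists_renewalFn_le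
  obtain ⟨D, hD, hle'⟩ := h.exists_climbMeasure_Iio_le
  exact .of_sq_le_mul (A := 4 * ENNReal.ofReal (variance (X 0) P)) (by finiteness) hD hC hle' hle
    fun t ht => h.sq_ofReal_le_climbMeasure_mul_renewalFn (by linarith)

end IsCenteredSteps

end LinearGrowth

section ConditionedGreenMeasure

namespace HasLinearGrowth

variable {f : ℝ → ℝ≥0∞}

lemma ne_top (hf : HasLinearGrowth f) {t : ℝ} (ht : 1 ≤ t) : f t ≠ ∞ := by
  obtain ⟨c, C, -, hC, hle⟩ := hf
  exact ne_top_of_le_ne_top (by finiteness) (hle t ht).2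

lemma exists_add_le (hf : HasLinearGrowth f) :
    ∃ (d : ℝ≥0∞) (K : ℝ), d ≠ 0 ∧ 2 ≤ K ∧
      ∀ t, K ≤ t → f (t / K) + d * ENNReal.ofReal t ≤ f (t / 2) := by
  obtain ⟨c, C, hc, hC, hle⟩ := hf
  set d : ℝ≥0∞ := c * ENNReal.ofReal 4⁻¹
  have hd : d ≠ 0 := by simp [d, hc]
  set K : ℝ := max 2 (C / d).toReal
  have hK : 0 < K := by positivity
  have hCK : C ≤ ENNReal.ofReal K * d := by
    refine (ENNReal.div_le_iff_le_mul (.inl hd) (.inr (ENNReal.ofReal_pos.2 hK).ne')).1 ?_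
    exact (ENNReal.ofReal_toReal (ENNReal.div_ne_top hC hd)).ge.trans
      (ENNReal.ofReal_le_ofReal (le_max_right _ _))
  refine ⟨d, K, hd, le_max_left _ _, fun t ht => ?_⟩
  have ht2 : 2 ≤ t := (le_max_left _ _).trans ht
  calc f (t / K) + d * ENNReal.ofReal t
      ≤ ENNReal.ofReal K * d * ENNReal.ofReal (t / K) + d * ENNReal.ofReal t := by
        gcongr
        exact (hle (t / K) ((one_le_div hK).2 ht)).2.trans (by gcongr)
    _ = d * ENNReal.ofReal t + d * ENNReal.ofReal t := by
        rw [mul_right_comm, ← ENNReal.ofReal_mul hK.le, mul_div_cancel₀ t hK.ne', mul_comm]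
    _ = c * ENNReal.ofReal (t / 2) := by
        rw [← mul_add, ← ENNReal.ofReal_add (by linarith) (by linarith), mul_assoc,
          ← ENNReal.ofReal_mul (by norm_num)]
        congr 2
        ring
    _ ≤ f (t / 2) := (hle (t / 2) (by linarith)).1

end HasLinearGrowth

/-- A weight `φ` that is non-increasing and finite, and constant up to the level `L`. -/
structure IsProfile (L : ℝ) (φ : ℝ → ℝ≥0∞) : Prop where
  antitone : Antitone φ
  ne_top : ∀ y, φ y ≠ ∞
  eq_of_le : ∀ y ≤ L, φ y = φ L

lemma measure_le_of_forall_Iic {μ : Measure ℝ} {A : Set ℝ} (hA : IsLowerSet A) {b : ℝ≥0∞}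
    (h : ∀ t ∈ A, μ (Iic t) ≤ b) : μ A ≤ b := by
  rcases A.eq_empty_or_nonempty with rfl | hne
  · simp
  have := hne.to_subtype
  have := hA.ordConnected
  obtain ⟨u, hu, hlim⟩ := Filter.exists_seq_monotone_tendsto_atTop_atTop A
  have hcover : A ⊆ ⋃ n, Iic (u n : ℝ) := fun t ht => by
    obtain ⟨n, hn⟩ := (hlim.eventually_ge_atTop ⟨t, ht⟩).exists
    exact mem_iUnion.2 ⟨n, hn⟩
  have hmono : Monotone fun n => Iic (u n : ℝ) := fun m n hmn => Iic_subset_Iic.2 (hu hmn)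
  calc μ A ≤ ⨆ n, μ (Iic (u n : ℝ)) := (measure_mono hcover).trans_eq hmono.measure_iUnion
    _ ≤ b := iSup_le fun n => h _ (u n).2

namespace IsProfile

variable {L : ℝ} {φ : ℝ → ℝ≥0∞}

lemma lintegral_le_lintegral (hφ : IsProfile L φ) {μ ν : Measure ℝ}
    (h : ∀ t, L ≤ t → μ (Iic t) ≤ ν (Iic t)) : ∫⁻ y, φ y ∂μ ≤ ∫⁻ y, φ y ∂ν := by
  have hanti : Antitone fun y => (φ y).toReal := fun a b hab =>
    ENNReal.toReal_mono (hφ.ne_top a) (hφ.antitone hab)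
  have hcake (μ : Measure ℝ) :
      ∫⁻ y, φ y ∂μ = ∫⁻ s in Ioi (0 : ℝ), μ {y | s < (φ y).toReal} := by
    rw [← lintegral_eq_lintegral_meas_lt μ (ae_of_all _ fun y => ENNReal.toReal_nonneg)
      hanti.measurable.aemeasurable]
    simp only [ENNReal.ofReal_toReal (hφ.ne_top _)]
  rw [hcake, hcake]
  refine lintegral_mono fun s => ?_
  have hlower : IsLowerSet {y | s < (φ y).toReal} := fun a b hba ha => ha.trans_le (hanti hba)
  refine measure_le_of_forall_Iic hlower fun t ht => ?_
  have hmax : max t L ∈ {y | s < (φ y).toReal} := by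
    rcases le_total t L with htL | htL
    · simpa only [max_eq_right htL, mem_ofPred_eq, ← hφ.eq_of_le t htL] using ht
    · simpa only [max_eq_left htL] using ht
  calc μ (Iic t) ≤ μ (Iic (max t L)) := measure_mono (Iic_subset_Iic.2 (le_max_left t L))
    _ ≤ ν (Iic (max t L)) := h _ (le_max_right t L)
    _ ≤ ν {y | s < (φ y).toReal} := measure_mono fun y hy => hlower hy hmax

end IsProfile

/-- The measure `y dy` on `[0, ∞)`, up to constants the Green measure of the conditioned walk; the
atom at `0` makes the comparison valid near the origin. -/
def heightMeasure : Measure ℝ :=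
  Measure.dirac 0 + (volume.restrict (Ici 0)).withDensity ENNReal.ofReal

lemma lintegral_heightMeasure {φ : ℝ → ℝ≥0∞} (hφ : Measurable φ) :
    ∫⁻ y, φ y ∂heightMeasure = φ 0 + ∫⁻ y in Ici 0, φ y * ENNReal.ofReal y := by
  rw [heightMeasure, lintegral_add_measure, lintegral_dirac' _ hφ,
    lintegral_withDensity_eq_lintegral_mul _ ENNReal.measurable_ofReal hφ]
  simp only [Pi.mul_apply, mul_comm]

lemma heightMeasure_Iic {t : ℝ} (ht : 0 ≤ t) :
    heightMeasure (Iic t) = ENNReal.ofReal (1 + t ^ 2 / 2) := by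
  have hdensity : ∫⁻ y in Icc 0 t, ENNReal.ofReal y = ENNReal.ofReal (t ^ 2 / 2) := by
    have hint : IntegrableOn (fun y : ℝ => y) (Icc 0 t) := continuous_id.integrableOn_Icc
    rw [← ofReal_integral_eq_lintegral_ofReal hint
      ((ae_restrict_mem measurableSet_Icc).mono fun y hy => hy.1), integral_Icc_eq_integral_Ioc,
      ← intervalIntegral.integral_of_le ht]
    simp
  rw [heightMeasure, Measure.add_apply, Measure.dirac_apply' _ measurableSet_Iic,
    withDensity_apply _ measurableSet_Iic, Measure.restrict_restrict measurableSet_Iic,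
    Iic_inter_Ici, hdensity, indicator_of_mem (mem_Iic.2 ht),
    ENNReal.ofReal_add zero_le_one (by positivity), ENNReal.ofReal_one, Pi.one_apply]

variable {Ω : Type*} [MeasurableSpace Ω]

/-- The measure with density `R` with respect to the Green measure of the killed walk started at
`x`: it is `R x` times the Green measure of the walk conditioned to stay positive and started at
`x`. -/
def conditionedGreenMeasure (P : Measure Ω) (X : ℕ → Ω → ℝ) (x : ℝ) : Measure ℝ :=
  (greenMeasure P X x).withDensity (renewalFn P (walk X))

namespace IsCenteredSteps

variable {P : Measure Ω} [IsProbabilityMeasure P] {X : ℕ → Ω → ℝ}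

lemma exists_conditionedGreenMeasure_Iio_le (h : IsCenteredSteps P X) :
    ∃ C : ℝ≥0∞, C ≠ ∞ ∧ ∀ x, 0 ≤ x → ∀ t, 1 ≤ t →
      conditionedGreenMeasure P X x (Iio t) ≤
        C * renewalFn P (walk X) x * ENNReal.ofReal (t ^ 2) := by
  obtain ⟨_, A, _, hA, hR⟩ := h.hasLinearGrowth_renewalFn
  obtain ⟨_, B, _, hB, hV⟩ := h.hasLinearGrowth_climbMeasure
  refine ⟨A * B, ENNReal.mul_ne_top hA hB, fun x hx t ht => ?_⟩
  calc conditionedGreenMeasure P X x (Iio t)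
      = ∫⁻ y in Iio t, renewalFn P (walk X) y ∂greenMeasure P X x :=
        withDensity_apply _ measurableSet_Iio
    _ ≤ ∫⁻ _ in Iio t, renewalFn P (walk X) t ∂greenMeasure P X x :=
        setLIntegral_mono measurable_const fun y hy => h.monotone_renewalFn (mem_Iio.1 hy).le
    _ = renewalFn P (walk X) t * greenMeasure P X x (Iio t) := setLIntegral_const _ _
    _ ≤ A * ENNReal.ofReal t * (B * ENNReal.ofReal t * renewalFn P (walk X) x) := by
        gcongr
        · exact (hR t ht).2
        · refine h.greenMeasure_le measurableSet_Iio hx fun z hz => ?_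
          rw [h.climbMeasure_Iio]
          exact (measure_mono (Iio_subset_Iio (by linarith [hz.1]))).trans (hV t ht).2
    _ = A * B * renewalFn P (walk X) x * ENNReal.ofReal (t ^ 2) := by
        rw [ENNReal.ofReal_pow (by linarith)]
        ring

lemma exists_le_greenMeasure_Ico (h : IsCenteredSteps P X) :
    ∃ (d : ℝ≥0∞) (K : ℝ), d ≠ 0 ∧ 2 ≤ K ∧ ∀ x, 0 ≤ x → ∀ t, K * (1 + x) ≤ t →
      d * ENNReal.ofReal t * renewalFn P (walk X) x ≤ greenMeasure P X x (Ico (t / K) t) := by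
  obtain ⟨d, K, hd, hK, hadd⟩ := h.hasLinearGrowth_climbMeasure.exists_add_le
  refine ⟨d, K, hd, hK, fun x hx t ht => h.le_greenMeasure measurableSet_Ico hx fun z hz => ?_⟩
  have hKt : K ≤ t := le_trans (by nlinarith) ht
  have hzt : z ≤ t / 2 := by nlinarith [hz.2]
  have hdiff : Iio t \ Iio (t / K) ⊆ Ico (t / K) t := fun y hy => ⟨not_lt.1 hy.2, hy.1⟩
  set V : ℝ → ℝ≥0∞ := fun t => climbMeasure P X 0 (Iio t)
  have hV : V (t / K) ≠ ∞ :=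
    h.hasLinearGrowth_climbMeasure.ne_top ((one_le_div (by linarith)).2 hKt)
  refine (ENNReal.add_le_add_iff_left hV).1 ?_
  calc V (t / K) + d * ENNReal.ofReal t ≤ V (t / 2) := hadd t hKt
    _ ≤ climbMeasure P X z (Iio t) := by
        rw [h.climbMeasure_Iio]
        exact measure_mono (Iio_subset_Iio (by linarith))
    _ ≤ climbMeasure P X z (Iio (t / K)) + climbMeasure P X z (Iio t \ Iio (t / K)) :=
        (measure_mono (subset_union_left.trans sdiff_union_self.ge |>.trans
          (union_comm _ _).subset)).trans (measure_union_le _ _)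
    _ ≤ V (t / K) + climbMeasure P X z (Ico (t / K) t) := by
        rw [h.climbMeasure_Iio]
        exact add_le_add (measure_mono (Iio_subset_Iio (by linarith [hz.1]))) (measure_mono hdiff)

lemma exists_le_conditionedGreenMeasure_Iio (h : IsCenteredSteps P X) :
    ∃ (c : ℝ≥0∞) (K : ℝ), c ≠ 0 ∧ 1 ≤ K ∧ ∀ x, 0 ≤ x → ∀ t, K * (1 + x) ≤ t →
      c * renewalFn P (walk X) x * ENNReal.ofReal (t ^ 2) ≤
        conditionedGreenMeasure P X x (Iio t) := by
  obtain ⟨a, _, ha, _, hR⟩ := h.hasLinearGrowth_renewalFn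
  obtain ⟨d, K, hd, hK, hgreen⟩ := h.exists_le_greenMeasure_Ico
  have hK0 : 0 < K := by linarith
  refine ⟨a * ENNReal.ofReal K⁻¹ * d, K, by simp [ha, hd, hK0], by linarith,
    fun x hx t ht => ?_⟩
  have hKt : K ≤ t := le_trans (by nlinarith) ht
  calc a * ENNReal.ofReal K⁻¹ * d * renewalFn P (walk X) x * ENNReal.ofReal (t ^ 2)
      = a * ENNReal.ofReal (t / K) * (d * ENNReal.ofReal t * renewalFn P (walk X) x) := by
        rw [ENNReal.ofReal_pow (by linarith), div_eq_inv_mul, ENNReal.ofReal_mul (by positivity)]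
        ring
    _ ≤ renewalFn P (walk X) (t / K) * greenMeasure P X x (Ico (t / K) t) := by
        gcongr
        · exact (hR _ ((one_le_div hK0).2 hKt)).1
        · exact hgreen x hx t ht
    _ = ∫⁻ _ in Ico (t / K) t, renewalFn P (walk X) (t / K) ∂greenMeasure P X x :=
        (setLIntegral_const _ _).symm
    _ ≤ ∫⁻ y in Ico (t / K) t, renewalFn P (walk X) y ∂greenMeasure P X x :=
        setLIntegral_mono h.measurable_renewalFn fun y hy => h.monotone_renewalFn hy.1
    _ ≤ ∫⁻ y in Iio t, renewalFn P (walk X) y ∂greenMeasure P X x :=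
        lintegral_mono_set Ico_subset_Iio_self
    _ = conditionedGreenMeasure P X x (Iio t) := (withDensity_apply _ measurableSet_Iio).symm

theorem exists_lintegral_conditionedGreenMeasure_le (h : IsCenteredSteps P X) :
    ∃ C : ℝ≥0∞, C ≠ ∞ ∧ ∀ x, 0 ≤ x → ∀ φ, IsProfile 0 φ →
      ∫⁻ y, φ y ∂conditionedGreenMeasure P X x ≤
        C * renewalFn P (walk X) x * ∫⁻ y, φ y ∂heightMeasure := by
  obtain ⟨C, hC, hle⟩ := h.exists_conditionedGreenMeasure_Iio_le
  refine ⟨C * ENNReal.ofReal 4, by finiteness, fun x hx φ hφ => ?_⟩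
  rw [← smul_eq_mul (a := C * _ * _), ← lintegral_smul_measure]
  refine hφ.lintegral_le_lintegral fun t ht => ?_
  calc conditionedGreenMeasure P X x (Iic t)
      ≤ conditionedGreenMeasure P X x (Iio (t + 1)) :=
        measure_mono (Iic_subset_Iio.2 (lt_add_one t))
    _ ≤ C * renewalFn P (walk X) x * ENNReal.ofReal ((t + 1) ^ 2) := hle x hx _ (by linarith)
    _ ≤ C * renewalFn P (walk X) x * ENNReal.ofReal (4 * (1 + t ^ 2 / 2)) := by
        gcongr
        nlinarith [sq_nonneg (t - 1)]
    _ = _ := by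
        rw [Measure.smul_apply, heightMeasure_Iic ht, ENNReal.ofReal_mul (by norm_num),
          smul_eq_mul]
        ring

theorem exists_le_lintegral_conditionedGreenMeasure (h : IsCenteredSteps P X) :
    ∃ (c : ℝ≥0∞) (K : ℝ), c ≠ 0 ∧ 1 ≤ K ∧ ∀ x, 0 ≤ x → ∀ L φ, K * (1 + x) ≤ L → IsProfile L φ →
      c * renewalFn P (walk X) x * ∫⁻ y, φ y ∂heightMeasure ≤
        ∫⁻ y, φ y ∂conditionedGreenMeasure P X x := by
  obtain ⟨c, K, hc, hK, hle⟩ := h.exists_le_conditionedGreenMeasure_Iio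
  refine ⟨c * ENNReal.ofReal 2⁻¹, K, by simp [hc], hK, fun x hx L φ hL hφ => ?_⟩
  rw [← smul_eq_mul (a := c * _ * _), ← lintegral_smul_measure]
  refine hφ.lintegral_le_lintegral fun t ht => ?_
  have ht1 : 1 ≤ t := by nlinarith
  calc (c * ENNReal.ofReal 2⁻¹ * renewalFn P (walk X) x) • heightMeasure (Iic t)
      = c * renewalFn P (walk X) x * ENNReal.ofReal (2⁻¹ * (1 + t ^ 2 / 2)) := by
        rw [heightMeasure_Iic (by linarith), ENNReal.ofReal_mul (by norm_num), smul_eq_mul]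
        ring
    _ ≤ c * renewalFn P (walk X) x * ENNReal.ofReal (t ^ 2) := by
        gcongr
        nlinarith
    _ ≤ conditionedGreenMeasure P X x (Iio t) := hle x hx t (hL.trans ht)
    _ ≤ conditionedGreenMeasure P X x (Iic t) := measure_mono Iio_subset_Iic_self

end IsCenteredSteps

end ConditionedGreenMeasure

section ConditionedPaths

lemma nonneg_of_mem_stayPositive {v : ℕ → ℝ} {n : ℕ} (hv : v ∈ stayPositive n) (h0 : 0 ≤ v 0) :
    0 ≤ v n := by
  rcases Nat.eq_zero_or_pos n with rfl | hn
  · exact h0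
  · exact (hv n hn le_rfl).le

lemma indicator_stayPositive_add (n m : ℕ) (v : ℕ → ℝ) :
    (stayPositive (n + m)).indicator (1 : (ℕ → ℝ) → ℝ≥0∞) v =
      (stayPositive n).indicator 1 v * (stayPositive m).indicator 1 (fun k => v (n + k)) := by
  have hiff : v ∈ stayPositive (n + m) ↔
      v ∈ stayPositive n ∧ (fun k => v (n + k)) ∈ stayPositive m := by
    refine ⟨fun hv => ⟨fun k h1 hk => hv k h1 (by omega),
      fun k h1 hk => hv _ (by omega) (by omega)⟩, fun ⟨hn, hm⟩ k h1 hk => ?_⟩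
    rcases le_or_gt k n with hkn | hnk
    · exact hn k h1 hkn
    · simpa only [Nat.add_sub_cancel' hnk.le] using hm (k - n) (by omega) (by omega)
  classical
  simp only [indicator_apply, hiff, Pi.one_apply, ite_and, ite_mul, one_mul, zero_mul]

variable {Ω Ω' : Type*} [MeasurableSpace Ω] [MeasurableSpace Ω'] {P : Measure Ω} {P' : Measure Ω'}
  {X : ℕ → Ω → ℝ} {ζ : ℕ → Ω' → ℝ}

namespace IsConditionedToStayPositive

variable (hζ : IsConditionedToStayPositive P (walk X) P' ζ)
include hζ

lemma measurable_path : Measurable fun ω' k => ζ k ω' :=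
  measurable_pi_iff.2 hζ.measurable

lemma lintegral_eq (h : IsIIDSteps P X) {n : ℕ} {g : (ℕ → ℝ) → ℝ≥0∞} (hg : Measurable g)
    (hgn : DependsOn g (Iic n)) :
    ∫⁻ ω', g (fun k => ζ k ω') ∂P' =
      ∫⁻ ω, (stayPositive n).indicator 1 (path X 0 ω) * g (path X 0 ω) *
        renewalFn P (walk X) (path X 0 ω n) ∂P := by
  set extend : (Fin (n + 1) → ℝ) → ℕ → ℝ := fun u k => u ⟨min k n, by omega⟩
  have hextend : Measurable extend := measurable_pi_iff.2 fun k => measurable_pi_apply _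
  have hg_extend (v : ℕ → ℝ) : g (extend fun i => v i) = g v := hgn fun k hk => by
    simp only [extend, min_eq_left (mem_Iic.1 hk)]
  have hlaw := hζ.law n (fun u => g (extend u)) (hg.comp hextend)
  have hzero : renewalFn P (walk X) 0 = 1 := if_neg (lt_irrefl 0)
  have hevent : {ω | ∀ k, 1 ≤ k → k ≤ n → 0 < path X 0 ω k} = path X 0 ⁻¹' stayPositive n := rfl
  have hζg (ω' : Ω') : g (extend fun i => ζ i ω') = g fun k => ζ k ω' :=
    hg_extend fun k => ζ k ω'
  have hXg (ω : Ω) : g (extend fun i => path X 0 ω i) = g (path X 0 ω) := hg_extend (path X 0 ω)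
  simp only [walk_eq_path, hzero, inv_one, one_mul, hζg, hXg] at hlaw
  rw [hlaw, hevent, ← lintegral_indicator (h.measurable_path 0 (measurableSet_stayPositive n))]
  classical
  simp only [indicator_apply, mem_preimage, Pi.one_apply, ite_mul, one_mul, zero_mul]

lemma ae_nonneg (h : IsIIDSteps P X) : ∀ᵐ ω' ∂P', ∀ n, 0 ≤ ζ n ω' := by
  refine ae_all_iff.2 fun n => ?_
  set negative : (ℕ → ℝ) → ℝ≥0∞ := {v | v n < 0}.indicator 1
  have hmeas : MeasurableSet {v : ℕ → ℝ | v n < 0} :=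
    measurableSet_lt (measurable_pi_apply n) measurable_const
  have hdep : DependsOn (· ∈ {v : ℕ → ℝ | v n < 0}) (Iic n) := fun _ _ huv => by
    simp only [mem_ofPred_eq, huv n self_mem_Iic]
  have hzero : ∫⁻ ω', negative (fun k => ζ k ω') ∂P' = 0 := by
    rw [hζ.lintegral_eq h (measurable_one.indicator hmeas) (dependsOn_indicator hdep)]
    refine (lintegral_congr fun ω => ?_).trans lintegral_zero
    by_cases hω : path X 0 ω ∈ stayPositive n
    · have := nonneg_of_mem_stayPositive hω (path_zero X 0 ω).ge
      simp [this.not_gt]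
    · simp [hω]
  have hnull : P' {ω' | ζ n ω' < 0} = 0 :=
    (lintegral_indicator_one (hζ.measurable_path hmeas)).symm.trans hzero
  simpa only [ae_iff, not_le] using hnull

variable [IsProbabilityMeasure P]

/-- The conditioned walk is a Markov process: given its path up to the time `n`, it goes on from
`ζ n` with the Green measure `conditionedGreenMeasure / R (ζ n)`. -/
lemma lintegral_mul_tsum_eq (h : IsIIDSteps P X) {n : ℕ} {g : (ℕ → ℝ) → ℝ≥0∞} (hg : Measurable g)
    (hgn : DependsOn g (Iic n)) {φ : ℝ → ℝ≥0∞} (hφ : Measurable φ) :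
    ∫⁻ ω', g (fun k => ζ k ω') * ∑' m, φ (ζ (n + m) ω') ∂P' =
      ∫⁻ ω, (stayPositive n).indicator 1 (path X 0 ω) * g (path X 0 ω) *
        ∫⁻ y, φ y ∂conditionedGreenMeasure P X (path X 0 ω n) ∂P := by
  have hR := h.measurable_renewalFn
  have hvisit (m : ℕ) : DependsOn (fun v : ℕ → ℝ => g v * φ (v (n + m))) (Iic (n + m)) :=
    fun u v huv => congr_arg₂ (· * ·) (hgn fun k hk => huv k (hk.trans (n.le_add_right m)))
      (congr_arg φ (huv _ self_mem_Iic))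
  have hterm (m : ℕ) : Measurable fun ω' => g (fun k => ζ k ω') * φ (ζ (n + m) ω') :=
    (hg.comp hζ.measurable_path).mul (hφ.comp (hζ.measurable _))
  calc ∫⁻ ω', g (fun k => ζ k ω') * ∑' m, φ (ζ (n + m) ω') ∂P'
      = ∑' m, ∫⁻ ω', g (fun k => ζ k ω') * φ (ζ (n + m) ω') ∂P' := by
        rw [← lintegral_tsum fun m => (hterm m).aemeasurable]
        simp only [ENNReal.tsum_mul_left]
    _ = ∑' m, ∫⁻ ω, (stayPositive n).indicator 1 (path X 0 ω) * g (path X 0 ω) *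
          ((stayPositive m).indicator 1 (fun k => path X 0 ω (n + k)) *
            (renewalFn P (walk X) * φ) (path X 0 ω (n + m))) ∂P :=
        tsum_congr fun m => by
          rw [hζ.lintegral_eq h (by fun_prop) (hvisit m)]
          refine lintegral_congr fun ω => ?_
          rw [indicator_stayPositive_add, Pi.mul_apply]
          ring
    _ = ∫⁻ ω, (stayPositive n).indicator 1 (path X 0 ω) * g (path X 0 ω) *
          ∫⁻ y, (renewalFn P (walk X) * φ) y ∂greenMeasure P X (path X 0 ω n) ∂P :=
        h.tsum_lintegral_mul_occupation measurableSet_stayPositive (hR.mul hφ)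
          ((measurable_one.indicator (measurableSet_stayPositive n)).mul hg)
          (fun u v huv => congr_arg₂ (· * ·)
            (dependsOn_indicator (dependsOn_stayPositive n) huv) (hgn huv)) 0
    _ = _ := by
        simp only [conditionedGreenMeasure, lintegral_withDensity_eq_lintegral_mul _ hR hφ]

lemma exists_lintegral_mul_tsum_le (h : IsCenteredSteps P X) :
    ∃ C : ℝ≥0∞, C ≠ ∞ ∧ ∀ φ, IsProfile 0 φ → ∀ n g, Measurable g → DependsOn g (Iic n) →
      ∫⁻ ω', g (fun k => ζ k ω') * ∑' m, φ (ζ (n + m) ω') ∂P' ≤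
        C * (∫⁻ y, φ y ∂heightMeasure) * ∫⁻ ω', g (fun k => ζ k ω') ∂P' := by
  obtain ⟨C, hC, hle⟩ := h.exists_lintegral_conditionedGreenMeasure_le
  refine ⟨C, hC, fun φ hφ n g hg hgn => ?_⟩
  have hmeas : Measurable fun ω => (stayPositive n).indicator 1 (path X 0 ω) * g (path X 0 ω) *
      renewalFn P (walk X) (path X 0 ω n) :=
    (((measurable_one.indicator (measurableSet_stayPositive n)).comp (h.measurable_path 0)).mul
      (hg.comp (h.measurable_path 0))).mul
      (h.measurable_renewalFn.comp (h.measurable_path_apply 0 n))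
  rw [hζ.lintegral_mul_tsum_eq h.toIsIIDSteps hg hgn hφ.antitone.measurable,
    hζ.lintegral_eq h.toIsIIDSteps hg hgn, ← lintegral_const_mul _ hmeas]
  refine lintegral_mono fun ω => ?_
  by_cases hω : path X 0 ω ∈ stayPositive n
  · have hpos := nonneg_of_mem_stayPositive hω (path_zero X 0 ω).ge
    calc _ ≤ (stayPositive n).indicator 1 (path X 0 ω) * g (path X 0 ω) *
          (C * renewalFn P (walk X) (path X 0 ω n) * ∫⁻ y, φ y ∂heightMeasure) := by
          gcongr
          exact hle _ hpos φ hφ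
      _ = _ := by ring
  · simp [hω]

lemma exists_le_lintegral_mul_tsum (h : IsCenteredSteps P X) :
    ∃ (c : ℝ≥0∞) (K : ℝ), c ≠ 0 ∧ ∀ ℓ L φ, K * (1 + ℓ) ≤ L → IsProfile L φ →
      ∀ n g, Measurable g → DependsOn g (Iic n) → (∀ v, ℓ < v n → g v = 0) →
        c * (∫⁻ y, φ y ∂heightMeasure) * ∫⁻ ω', g (fun k => ζ k ω') ∂P' ≤
          ∫⁻ ω', g (fun k => ζ k ω') * ∑' m, φ (ζ (n + m) ω') ∂P' := by
  obtain ⟨c, K, hc, hK, hle⟩ := h.exists_le_lintegral_conditionedGreenMeasure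
  refine ⟨c, K, hc, fun ℓ L φ hL hφ n g hg hgn hgℓ => ?_⟩
  rw [hζ.lintegral_mul_tsum_eq h.toIsIIDSteps hg hgn hφ.antitone.measurable,
    hζ.lintegral_eq h.toIsIIDSteps hg hgn]
  refine (lintegral_const_mul_le _ _).trans ?_
  refine lintegral_mono fun ω => ?_
  by_cases hω : path X 0 ω ∈ stayPositive n
  · have hpos := nonneg_of_mem_stayPositive hω (path_zero X 0 ω).ge
    rcases le_or_gt (path X 0 ω n) ℓ with hlow | hhigh
    · calc _ = (stayPositive n).indicator 1 (path X 0 ω) * g (path X 0 ω) *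
            (c * renewalFn P (walk X) (path X 0 ω n) * ∫⁻ y, φ y ∂heightMeasure) := by ring
        _ ≤ _ := by
          gcongr
          exact hle _ hpos L φ (le_trans (by gcongr) hL) hφ
    · simp [hgℓ _ hhigh]
  · simp [hω]

end IsConditionedToStayPositive

end ConditionedPaths

namespace IsProfile

variable {L : ℝ} {φ : ℝ → ℝ≥0∞}

lemma comp_max (hφ : IsProfile L φ) (T : ℝ) : IsProfile T fun y => φ (max y T) where
  antitone _ _ hab := hφ.antitone (max_le_max_right T hab)
  ne_top _ := hφ.ne_top _
  eq_of_le y hy := by rw [max_eq_right hy, max_self]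

lemma indicator_Iic (hφ : IsProfile L φ) {t : ℝ} (ht : L ≤ t) :
    IsProfile L ((Iic t).indicator φ) where
  antitone a b hab := by
    by_cases hb : b ≤ t
    · rw [indicator_of_mem (mem_Iic.2 hb), indicator_of_mem (mem_Iic.2 (hab.trans hb))]
      exact hφ.antitone hab
    · rw [indicator_of_notMem (notMem_Iic.2 (not_le.1 hb))]
      exact zero_le
  ne_top y := ne_top_of_le_ne_top (hφ.ne_top y) (indicator_le_self _ _ _)
  eq_of_le y hy := by
    rw [indicator_of_mem (mem_Iic.2 (hy.trans ht)), indicator_of_mem (mem_Iic.2 ht),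
      hφ.eq_of_le y hy]

lemma mono {L' : ℝ} (hφ : IsProfile L φ) (hL : L' ≤ L) : IsProfile L' φ where
  antitone := hφ.antitone
  ne_top := hφ.ne_top
  eq_of_le y hy := (hφ.eq_of_le y (hy.trans hL)).trans (hφ.eq_of_le L' hL).symm

lemma setLIntegral_Iic_ne_top (hφ : IsProfile 0 φ) {t : ℝ} (ht : 0 ≤ t) :
    ∫⁻ y in Iic t, φ y ∂heightMeasure ≠ ∞ := by
  have hle : ∫⁻ y in Iic t, φ y ∂heightMeasure ≤ φ 0 * heightMeasure (Iic t) := by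
    rw [← setLIntegral_const]
    refine lintegral_mono fun y => ?_
    rcases le_total y 0 with hy | hy
    · exact (hφ.eq_of_le y hy).le
    · exact hφ.antitone hy
  rw [heightMeasure_Iic ht] at hle
  exact ne_top_of_le_ne_top (ENNReal.mul_ne_top (hφ.ne_top 0) ENNReal.ofReal_ne_top) hle

lemma lintegral_comp_max_eq_top (hφ : IsProfile 0 φ) (hint : ∫⁻ y, φ y ∂heightMeasure = ∞)
    {L : ℝ} (hL : 0 ≤ L) : ∫⁻ y, φ (max y L) ∂heightMeasure = ∞ := by
  by_contra hfin
  refine (ENNReal.add_ne_top.2 ⟨hφ.setLIntegral_Iic_ne_top hL, hfin⟩) (top_le_iff.1 ?_)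
  rw [← hint, ← lintegral_add_compl φ (measurableSet_Iic (a := L))]
  refine add_le_add_right ?_ _
  refine (setLIntegral_mono (hφ.comp_max L).antitone.measurable fun y hy => ?_).trans
    (setLIntegral_le_lintegral _ _)
  rw [max_eq_left (notMem_Iic.1 hy).le]

lemma exists_le_lintegral (hφ : IsProfile 0 φ) (hint : ∫⁻ y, φ y ∂heightMeasure = ∞) (L : ℝ)
    {M : ℝ≥0∞} (hM : M ≠ ∞) :
    ∃ ψ, IsProfile L ψ ∧ IsProfile 0 ψ ∧ (∀ y, ψ y ≤ φ y) ∧ M < ∫⁻ y, ψ y ∂heightMeasure ∧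
      ∫⁻ y, ψ y ∂heightMeasure ≠ ∞ := by
  set T : ℝ := max L 0
  have hT : IsProfile T fun y => φ (max y T) := hφ.comp_max T
  set ψ : ℕ → ℝ → ℝ≥0∞ := fun N => (Iic (T + N)).indicator fun y => φ (max y T)
  have hψ (N : ℕ) : IsProfile T (ψ N) := hT.indicator_Iic (le_add_of_nonneg_right N.cast_nonneg)
  have hψ_int (N : ℕ) :
      ∫⁻ y, ψ N y ∂heightMeasure = ∫⁻ y in Iic (T + N), φ (max y T) ∂heightMeasure :=
    lintegral_indicator measurableSet_Iic _
  have hmono : Monotone fun N : ℕ => Iic (T + N) := fun a b hab => Iic_subset_Iic.2 (by gcongr)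
  have hcover : ⋃ N : ℕ, Iic (T + N) = univ := eq_univ_of_forall fun y => by
    obtain ⟨N, hN⟩ := exists_nat_ge (y - T)
    exact mem_iUnion.2 ⟨N, mem_Iic.2 (by linarith)⟩
  have hsup : ⨆ N : ℕ, ∫⁻ y, ψ N y ∂heightMeasure = ∞ := by
    simp only [hψ_int]
    rw [← setLIntegral_iUnion_of_directed _ hmono.directed_le, hcover, setLIntegral_univ,
      hφ.lintegral_comp_max_eq_top hint (le_max_right L 0)]
  obtain ⟨N, hN⟩ := lt_iSup_iff.1 (hM.lt_top.trans_eq hsup.symm)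
  have hfin : ∫⁻ y, ψ N y ∂heightMeasure ≠ ∞ := by
    rw [hψ_int]
    exact (hT.mono (le_max_right L 0)).setLIntegral_Iic_ne_top (by positivity)
  exact ⟨ψ N, (hψ N).mono (le_max_left L 0), (hψ N).mono (le_max_right L 0),
    fun y => (indicator_le_self _ _ y).trans (hφ.antitone (le_max_left y T)), hN, hfin⟩

end IsProfile

section SecondMoment

lemma sq_tsum_le (a : ℕ → ℝ≥0∞) : (∑' i, a i) ^ 2 ≤ 2 * ∑' i, ∑' j, a i * a (i + j) := by
  have hshift (i : ℕ) : ∑' j, a i * a (i + j) = ∑' k, if i ≤ k then a i * a k else 0 := by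
    rw [← (add_right_injective i).tsum_eq (f := fun k => if i ≤ k then a i * a k else 0)]
    · simp
    · intro k hk
      simp only [Function.mem_support, ne_eq, ite_eq_right_iff, not_forall] at hk
      obtain ⟨hk, -⟩ := hk
      exact ⟨k - i, Nat.add_sub_cancel' hk⟩
  simp_rw [hshift]
  calc (∑' i, a i) ^ 2 = ∑' i, ∑' k, a i * a k := by
        rw [sq, ← ENNReal.tsum_mul_right]
        exact tsum_congr fun i => ENNReal.tsum_mul_left.symm
    _ ≤ ∑' i, ∑' k, ((if i ≤ k then a i * a k else 0) + if k ≤ i then a k * a i else 0) := by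
        gcongr with i k
        rcases le_total i k with hik | hik
        · rw [if_pos hik]; exact le_self_add
        · rw [if_pos hik, mul_comm]; exact le_add_self
    _ = 2 * ∑' i, ∑' k, if i ≤ k then a i * a k else 0 := by
        simp_rw [ENNReal.tsum_add]
        rw [ENNReal.tsum_comm (f := fun i k => if k ≤ i then a k * a i else 0), two_mul]

lemma lintegral_mul_sq_tsum_le {α : Type*} [MeasurableSpace α] {μ : Measure α} {f : α → ℝ≥0∞}
    {a : ℕ → α → ℝ≥0∞} (hf : Measurable f) (ha : ∀ i, Measurable (a i)) :
    ∫⁻ x, f x * (∑' i, a i x) ^ 2 ∂μ ≤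
      2 * ∑' i, ∫⁻ x, f x * a i x * ∑' j, a (i + j) x ∂μ := by
  have hterm (i : ℕ) : Measurable fun x => f x * a i x * ∑' j, a (i + j) x :=
    (hf.mul (ha i)).mul (.tsum fun j => ha (i + j))
  rw [← lintegral_tsum fun i => (hterm i).aemeasurable, ← lintegral_const_mul _ (.tsum hterm)]
  refine lintegral_mono fun x => ?_
  calc f x * (∑' i, a i x) ^ 2 ≤ f x * (2 * ∑' i, ∑' j, a i x * a (i + j) x) := by
        gcongr
        exact sq_tsum_le fun i => a i x
    _ = 2 * ∑' i, f x * a i x * ∑' j, a (i + j) x := by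
        simp only [ENNReal.tsum_mul_left, mul_assoc]
        ring

lemma lintegral_indicator_one_mul {α : Type*} [MeasurableSpace α] {μ : Measure α} {s : Set α}
    (hs : MeasurableSet s) (f : α → ℝ≥0∞) :
    ∫⁻ x, s.indicator 1 x * f x ∂μ = ∫⁻ x in s, f x ∂μ := by
  classical
  rw [← lintegral_indicator hs]
  simp only [indicator_apply, Pi.one_apply, ite_mul, one_mul, zero_mul]

lemma sq_lintegral_mul_le {α : Type*} [MeasurableSpace α] {μ : Measure α} {f g : α → ℝ≥0∞}
    (hf : AEMeasurable f μ) (hg : AEMeasurable g μ) :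
    (∫⁻ x, f x * g x ∂μ) ^ 2 ≤ (∫⁻ x, f x ^ 2 ∂μ) * ∫⁻ x, g x ^ 2 ∂μ := by
  have hsqrt (a : ℝ≥0∞) : (a ^ (1 / 2 : ℝ)) ^ 2 = a := by
    rw [← ENNReal.rpow_natCast, ← ENNReal.rpow_mul]
    norm_num
  have hHolder := ENNReal.lintegral_mul_le_Lp_mul_Lq μ Real.HolderConjugate.two_two hf hg
  simp only [ENNReal.rpow_two, Pi.mul_apply] at hHolder
  calc (∫⁻ x, f x * g x ∂μ) ^ 2
      ≤ ((∫⁻ x, f x ^ 2 ∂μ) ^ (1 / 2 : ℝ) * (∫⁻ x, g x ^ 2 ∂μ) ^ (1 / 2 : ℝ)) ^ 2 := by gcongr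
    _ = (∫⁻ x, f x ^ 2 ∂μ) * ∫⁻ x, g x ^ 2 ∂μ := by rw [mul_pow, hsqrt, hsqrt]

lemma paley_zygmund {α : Type*} [MeasurableSpace α] {μ : Measure α} [IsFiniteMeasure μ]
    {A : α → ℝ≥0∞} (hA : Measurable A) {b : ℝ≥0∞} (hb : b ≠ ∞)
    (hmean : 2 * b * μ univ ≤ ∫⁻ x, A x ∂μ) :
    (b * μ univ) ^ 2 ≤ (∫⁻ x, A x ^ 2 ∂μ) * μ {x | b ≤ A x} := by
  set large : Set α := {x | b ≤ A x}
  have hlarge : MeasurableSet large := measurableSet_le measurable_const hA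
  have hsmall : ∫⁻ x in largeᶜ, A x ∂μ ≤ b * μ univ :=
    calc ∫⁻ x in largeᶜ, A x ∂μ ≤ ∫⁻ _ in largeᶜ, b ∂μ :=
          setLIntegral_mono measurable_const fun x hx => (not_le.1 (show ¬b ≤ A x from hx)).le
      _ ≤ b * μ univ := by
          rw [setLIntegral_const]
          gcongr
          exact subset_univ _
  have hhalf : b * μ univ ≤ ∫⁻ x in large, A x ∂μ := by
    refine (ENNReal.add_le_add_iff_right (ENNReal.mul_ne_top hb (measure_ne_top μ univ))).1 ?_
    calc b * μ univ + b * μ univ = 2 * b * μ univ := by ring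
      _ ≤ ∫⁻ x in large, A x ∂μ + ∫⁻ x in largeᶜ, A x ∂μ :=
          hmean.trans_eq (lintegral_add_compl A hlarge).symm
      _ ≤ ∫⁻ x in large, A x ∂μ + b * μ univ := add_le_add_right hsmall _
  calc (b * μ univ) ^ 2
      ≤ (∫⁻ x in large, A x * 1 ∂μ) ^ 2 := by
        simpa only [mul_one] using pow_le_pow_left' hhalf 2
    _ ≤ (∫⁻ x in large, A x ^ 2 ∂μ) * ∫⁻ _ in large, 1 ^ 2 ∂μ :=
        sq_lintegral_mul_le hA.aemeasurable aemeasurable_const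
    _ ≤ (∫⁻ x, A x ^ 2 ∂μ) * μ large := by
        rw [one_pow, setLIntegral_one]
        exact mul_le_mul_left (setLIntegral_le_lintegral _ _) _

/-- The cylinders approximate `Eᶜ`, so a uniform lower bound on the conditional probabilities of `E`
given cylinders leaves no mass for `Eᶜ`. -/
lemma measure_compl_eq_zero_of_cylinders {Q : Measure (ℕ → ℝ)} [IsFiniteMeasure Q]
    {E : Set (ℕ → ℝ)} (hE : MeasurableSet E) {κ : ℝ≥0∞} (hκ : κ ≠ 0) (hκ_top : κ ≠ ∞)
    (h : ∀ D ∈ measurableCylinders fun _ : ℕ => ℝ, κ * Q D ≤ Q (D ∩ E)) : Q Eᶜ = 0 := by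
  have hring : IsSetRing (measurableCylinders fun _ : ℕ => ℝ) :=
    ⟨empty_mem_measurableCylinders _, fun _ _ => union_mem_measurableCylinders,
      fun _ _ => sdiff_mem_measurableCylinders⟩
  have hle (ε : ℝ≥0∞) (hε : 0 < ε) : κ * Q Eᶜ ≤ (1 + κ) * ε := by
    obtain ⟨D, hD, hDE⟩ := exists_measure_symmDiff_lt_of_generateFrom_isSetRing (μ := Q) hring
      ⟨{univ}, countable_singleton _, by simpa using univ_mem_measurableCylinders fun _ : ℕ => ℝ,
        by simp⟩
      generateFrom_measurableCylinders.symm hE.compl hε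
    have hinter : Q (D ∩ E) ≤ ε :=
      (measure_mono fun x hx => .inl ⟨hx.1, not_not.2 hx.2⟩).trans hDE.le
    have hcompl : Q Eᶜ ≤ Q D + ε :=
      calc Q Eᶜ ≤ Q (D ∪ symmDiff D Eᶜ) := measure_mono fun x hx =>
            (em (x ∈ D)).imp id fun hxD => .inr ⟨hx, hxD⟩
        _ ≤ Q D + ε := (measure_union_le _ _).trans (by gcongr)
    calc κ * Q Eᶜ ≤ κ * Q D + κ * ε := (mul_le_mul_right hcompl κ).trans_eq (mul_add _ _ _)
      _ ≤ ε + κ * ε := by gcongr; exact (h D hD).trans hinter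
      _ = (1 + κ) * ε := by ring
  have hlim : Filter.Tendsto (fun n : ℕ => (1 + κ) * (n : ℝ≥0∞)⁻¹) Filter.atTop (nhds 0) := by
    simpa only [mul_zero] using ENNReal.Tendsto.const_mul ENNReal.tendsto_inv_nat_nhds_zero
      (.inr (ENNReal.add_ne_top.2 ⟨ENNReal.one_ne_top, hκ_top⟩))
  have hzero : κ * Q Eᶜ = 0 :=
    le_antisymm (ge_of_tendsto' hlim fun n => hle _ (by simp)) zero_le
  exact (mul_eq_zero.1 hzero).resolve_left hκ

end SecondMoment

section Divergence

variable {Ω Ω' : Type*} [MeasurableSpace Ω] [MeasurableSpace Ω'] {P : Measure Ω} {P' : Measure Ω'}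
  [IsProbabilityMeasure P] {X : ℕ → Ω → ℝ} {ζ : ℕ → Ω' → ℝ}

lemma exists_dependsOn_of_mem_measurableCylinders {D : Set (ℕ → ℝ)}
    (hD : D ∈ measurableCylinders fun _ : ℕ => ℝ) : ∃ n, DependsOn (· ∈ D) (Iic n) := by
  obtain ⟨s, S, -, rfl⟩ := (mem_measurableCylinders D).1 hD
  refine ⟨s.sup id, fun u v huv => ?_⟩
  have hrestrict : s.restrict u = s.restrict v :=
    funext fun i => huv i (mem_Iic.2 (Finset.le_sup (f := id) i.2))
  simp only [mem_cylinder, hrestrict]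

namespace IsConditionedToStayPositive

variable (hζ : IsConditionedToStayPositive P (walk X) P' ζ)
include hζ

lemma exists_lintegral_tsum_le (h : IsCenteredSteps P X) :
    ∃ C : ℝ≥0∞, C ≠ ∞ ∧ ∀ φ, IsProfile 0 φ →
      ∫⁻ ω', ∑' m, φ (ζ m ω') ∂P' ≤ C * (∫⁻ y, φ y ∂heightMeasure) * P' univ := by
  obtain ⟨C, hC, hle⟩ := hζ.exists_lintegral_mul_tsum_le h
  refine ⟨C, hC, fun φ hφ => ?_⟩
  simpa only [Pi.one_apply, one_mul, zero_add, lintegral_one] using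
    hle φ hφ 0 1 measurable_one fun _ _ _ => rfl

lemma exists_lintegral_mul_sq_tsum_le (h : IsCenteredSteps P X) :
    ∃ C : ℝ≥0∞, C ≠ ∞ ∧ ∀ φ, IsProfile 0 φ → ∀ n g, Measurable g → DependsOn g (Iic n) →
      ∫⁻ ω', g (fun k => ζ k ω') * (∑' m, φ (ζ (n + m) ω')) ^ 2 ∂P' ≤
        2 * (C * ∫⁻ y, φ y ∂heightMeasure) ^ 2 * ∫⁻ ω', g (fun k => ζ k ω') ∂P' := by
  obtain ⟨C, hC, hle⟩ := hζ.exists_lintegral_mul_tsum_le h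
  refine ⟨C, hC, fun φ hφ n g hg hgn => ?_⟩
  set I := ∫⁻ y, φ y ∂heightMeasure
  have hφζ (m : ℕ) : Measurable fun ω' => φ (ζ m ω') :=
    hφ.antitone.measurable.comp (hζ.measurable m)
  have hgφ (i : ℕ) : Measurable fun v : ℕ → ℝ => g v * φ (v (n + i)) :=
    hg.mul (hφ.antitone.measurable.comp (measurable_pi_apply _))
  have hvisit (i : ℕ) : DependsOn (fun v : ℕ → ℝ => g v * φ (v (n + i))) (Iic (n + i)) :=
    fun u v huv => congr_arg₂ (· * ·) (hgn fun k hk => huv k (hk.trans (n.le_add_right i)))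
      (congr_arg φ (huv _ self_mem_Iic))
  calc ∫⁻ ω', g (fun k => ζ k ω') * (∑' m, φ (ζ (n + m) ω')) ^ 2 ∂P'
      ≤ 2 * ∑' i, ∫⁻ ω', g (fun k => ζ k ω') * φ (ζ (n + i) ω') *
          ∑' j, φ (ζ (n + (i + j)) ω') ∂P' :=
        lintegral_mul_sq_tsum_le (hg.comp hζ.measurable_path) fun m => hφζ (n + m)
    _ ≤ 2 * ∑' i, C * I * ∫⁻ ω', g (fun k => ζ k ω') * φ (ζ (n + i) ω') ∂P' := by
        simp only [← add_assoc]
        gcongr with i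
        exact hle φ hφ (n + i) _ (hgφ i) (hvisit i)
    _ = 2 * (C * I * ∫⁻ ω', g (fun k => ζ k ω') * ∑' m, φ (ζ (n + m) ω') ∂P') := by
        have hterm (i : ℕ) : Measurable fun ω' => g (fun k => ζ k ω') * φ (ζ (n + i) ω') :=
          (hgφ i).comp hζ.measurable_path
        rw [ENNReal.tsum_mul_left, ← lintegral_tsum fun i => (hterm i).aemeasurable]
        simp only [ENNReal.tsum_mul_left]
    _ ≤ 2 * (C * I * (C * I * ∫⁻ ω', g (fun k => ζ k ω') ∂P')) := by
        gcongr
        exact hle φ hφ n g hg hgn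
    _ = 2 * (C * I) ^ 2 * ∫⁻ ω', g (fun k => ζ k ω') ∂P' := by ring

lemma exists_le_setLIntegral_tsum (h : IsCenteredSteps P X) :
    ∃ (c : ℝ≥0∞) (K : ℝ), c ≠ 0 ∧ ∀ ℓ φ, IsProfile (K * (1 + ℓ)) φ → ∀ n D, MeasurableSet D →
      DependsOn (· ∈ D) (Iic n) → (∀ v ∈ D, v n ≤ ℓ) →
        c * (∫⁻ y, φ y ∂heightMeasure) * P' {ω' | (fun k => ζ k ω') ∈ D} ≤
          ∫⁻ ω' in {ω' | (fun k => ζ k ω') ∈ D}, ∑' m, φ (ζ (n + m) ω') ∂P' := by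
  obtain ⟨c, K, hc, hle⟩ := hζ.exists_le_lintegral_mul_tsum h
  refine ⟨c, K, hc, fun ℓ φ hφ n D hD hDn hDℓ => ?_⟩
  have hpast : MeasurableSet {ω' | (fun k => ζ k ω') ∈ D} := hζ.measurable_path hD
  rw [← lintegral_indicator_one hpast, ← lintegral_indicator_one_mul hpast]
  exact hle ℓ _ φ le_rfl hφ n (D.indicator 1) (measurable_one.indicator hD)
    (dependsOn_indicator hDn) fun v hv => indicator_of_notMem (fun hvD => (hDℓ v hvD).not_gt hv) _

lemma exists_setLIntegral_sq_tsum_le (h : IsCenteredSteps P X) :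
    ∃ C : ℝ≥0∞, C ≠ ∞ ∧ ∀ φ, IsProfile 0 φ → ∀ n D, MeasurableSet D → DependsOn (· ∈ D) (Iic n) →
      ∫⁻ ω' in {ω' | (fun k => ζ k ω') ∈ D}, (∑' m, φ (ζ (n + m) ω')) ^ 2 ∂P' ≤
        2 * (C * ∫⁻ y, φ y ∂heightMeasure) ^ 2 * P' {ω' | (fun k => ζ k ω') ∈ D} := by
  obtain ⟨C, hC, hle⟩ := hζ.exists_lintegral_mul_sq_tsum_le h
  refine ⟨C, hC, fun φ hφ n D hD hDn => ?_⟩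
  have hpast : MeasurableSet {ω' | (fun k => ζ k ω') ∈ D} := hζ.measurable_path hD
  rw [← lintegral_indicator_one hpast, ← lintegral_indicator_one_mul hpast]
  exact hle φ hφ n (D.indicator 1) (measurable_one.indicator hD) (dependsOn_indicator hDn)

variable [IsFiniteMeasure P']

lemma exists_sq_mul_measure_le (h : IsCenteredSteps P X) :
    ∃ (c C : ℝ≥0∞) (K : ℝ), c ≠ 0 ∧ C ≠ ∞ ∧ ∀ ℓ φ, IsProfile (K * (1 + ℓ)) φ → IsProfile 0 φ →
      ∫⁻ y, φ y ∂heightMeasure ≠ ∞ →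
      ∀ n D, MeasurableSet D → DependsOn (· ∈ D) (Iic n) → (∀ v ∈ D, v n ≤ ℓ) →
        ((c * ∫⁻ y, φ y ∂heightMeasure) * P' {ω' | (fun k => ζ k ω') ∈ D}) ^ 2 ≤
          2 * (C * ∫⁻ y, φ y ∂heightMeasure) ^ 2 * P' {ω' | (fun k => ζ k ω') ∈ D} *
            P' ({ω' | (fun k => ζ k ω') ∈ D} ∩
              {ω' | c * ∫⁻ y, φ y ∂heightMeasure ≤ ∑' m, φ (ζ (n + m) ω')}) := by
  obtain ⟨a, K, ha, hmean⟩ := hζ.exists_le_setLIntegral_tsum h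
  obtain ⟨C, hC, hsq⟩ := hζ.exists_setLIntegral_sq_tsum_le h
  set c : ℝ≥0∞ := min (a / 2) 1
  have hc : c ≠ 0 := by simp [c, ha]
  have hc_top : c ≠ ∞ := ne_top_of_le_ne_top ENNReal.one_ne_top (min_le_right _ _)
  have hca : 2 * c ≤ a := by
    rw [mul_comm]
    exact (ENNReal.le_div_iff_mul_le (by simp) (by simp)).1 (min_le_left _ _)
  refine ⟨c, C, K, hc, hC, fun ℓ φ hφK hφ hI n D hD hDn hDℓ => ?_⟩
  have hsum : Measurable fun ω' => ∑' m, φ (ζ (n + m) ω') :=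
    .tsum fun m => hφ.antitone.measurable.comp (hζ.measurable (n + m))
  have hmean_c : 2 * (c * ∫⁻ y, φ y ∂heightMeasure) *
      P'.restrict {ω' | (fun k => ζ k ω') ∈ D} univ ≤
        ∫⁻ ω' in {ω' | (fun k => ζ k ω') ∈ D}, ∑' m, φ (ζ (n + m) ω') ∂P' := by
    rw [Measure.restrict_apply_univ, ← mul_assoc]
    exact le_trans (by gcongr) (hmean ℓ φ hφK n D hD hDn hDℓ)
  have hPZ := paley_zygmund hsum (ENNReal.mul_ne_top hc_top hI) hmean_c
  rw [Measure.restrict_apply_univ,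
    Measure.restrict_apply (measurableSet_le measurable_const hsum), inter_comm] at hPZ
  exact hPZ.trans (mul_le_mul_left (hsq φ hφ n D hD hDn) _)

lemma exists_mul_measure_le (h : IsCenteredSteps P X) :
    ∃ (κ c : ℝ≥0∞) (K : ℝ), κ ≠ 0 ∧ c ≠ 0 ∧ ∀ ℓ φ, IsProfile (K * (1 + ℓ)) φ → IsProfile 0 φ →
      ∫⁻ y, φ y ∂heightMeasure ≠ 0 → ∫⁻ y, φ y ∂heightMeasure ≠ ∞ →
      ∀ n D, MeasurableSet D → DependsOn (· ∈ D) (Iic n) → (∀ v ∈ D, v n ≤ ℓ) →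
        κ * P' {ω' | (fun k => ζ k ω') ∈ D} ≤ P' ({ω' | (fun k => ζ k ω') ∈ D} ∩
          {ω' | c * ∫⁻ y, φ y ∂heightMeasure ≤ ∑' m, φ (ζ (n + m) ω')}) := by
  obtain ⟨c, C, K, hc, hC, hsq⟩ := hζ.exists_sq_mul_measure_le h
  refine ⟨c ^ 2 / (2 * C ^ 2), c, K, ENNReal.div_ne_zero.2 ⟨pow_ne_zero 2 hc, by finiteness⟩, hc,
    fun ℓ φ hφK hφ hI hI_top n D hD hDn hDℓ => ?_⟩
  set I := ∫⁻ y, φ y ∂heightMeasure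
  set past : Set Ω' := {ω' | (fun k => ζ k ω') ∈ D}
  set large : Set Ω' := {ω' | c * I ≤ ∑' m, φ (ζ (n + m) ω')}
  rcases eq_or_ne (P' past) 0 with hnull | hpos
  · simp [hnull]
  rw [mul_comm, ← mul_div_assoc]
  refine ENNReal.div_le_of_le_mul ?_
  have hI2 : I ^ 2 * P' past ≠ 0 := mul_ne_zero (pow_ne_zero 2 hI) hpos
  have hI2_top : I ^ 2 * P' past ≠ ∞ := by finiteness
  refine (ENNReal.mul_le_mul_iff_right hI2 hI2_top).1 ?_
  calc I ^ 2 * P' past * (P' past * c ^ 2) = (c * I * P' past) ^ 2 := by ring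
    _ ≤ 2 * (C * I) ^ 2 * P' past * P' (past ∩ large) := hsq ℓ φ hφK hφ hI_top n D hD hDn hDℓ
    _ = I ^ 2 * P' past * (P' (past ∩ large) * (2 * C ^ 2)) := by ring

lemma exists_mul_measure_le_measure_le_tsum (h : IsCenteredSteps P X) :
    ∃ κ : ℝ≥0∞, κ ≠ 0 ∧ ∀ φ, IsProfile 0 φ → ∫⁻ y, φ y ∂heightMeasure = ∞ →
      ∀ (M : ℕ) (ℓ : ℝ) n D, MeasurableSet D → DependsOn (· ∈ D) (Iic n) → (∀ v ∈ D, v n ≤ ℓ) →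
        κ * P' {ω' | (fun k => ζ k ω') ∈ D} ≤
          P' ({ω' | (fun k => ζ k ω') ∈ D} ∩ {ω' | M ≤ ∑' m, φ (ζ m ω')}) := by
  obtain ⟨κ, c, K, hκ, hc, hle⟩ := hζ.exists_mul_measure_le h
  refine ⟨κ, hκ, fun φ hφ hint M ℓ n D hD hDn hDℓ => ?_⟩
  obtain ⟨ψ, hψK, hψ, hψφ, hMψ, hψ_top⟩ := hφ.exists_le_lintegral hint (K * (1 + ℓ))
    (ENNReal.div_ne_top (ENNReal.natCast_ne_top M) hc)
  refine (hle ℓ ψ hψK hψ (ne_bot_of_gt hMψ) hψ_top n D hD hDn hDℓ).trans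
    (measure_mono (inter_subset_inter_right _ fun ω' hω' => ?_))
  calc (M : ℝ≥0∞) ≤ c * ∫⁻ y, ψ y ∂heightMeasure := by
        rw [mul_comm]
        exact (ENNReal.div_le_iff_le_mul (.inl hc) (.inr (ne_bot_of_gt hMψ))).1 hMψ.le
    _ ≤ ∑' m, ψ (ζ (n + m) ω') := hω'
    _ ≤ ∑' m, φ (ζ (n + m) ω') := ENNReal.tsum_le_tsum fun m => hψφ _
    _ ≤ ∑' m, φ (ζ m ω') :=
        ENNReal.tsum_comp_le_tsum_of_injective (add_right_injective n) fun m => φ (ζ m ω')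

lemma exists_mul_measure_le_measure_tsum_eq_top_of_forall_le (h : IsCenteredSteps P X) :
    ∃ κ : ℝ≥0∞, κ ≠ 0 ∧ ∀ φ, IsProfile 0 φ → ∫⁻ y, φ y ∂heightMeasure = ∞ →
      ∀ (ℓ : ℝ) n D, MeasurableSet D → DependsOn (· ∈ D) (Iic n) → (∀ v ∈ D, v n ≤ ℓ) →
        κ * P' {ω' | (fun k => ζ k ω') ∈ D} ≤
          P' ({ω' | (fun k => ζ k ω') ∈ D} ∩ {ω' | ∑' m, φ (ζ m ω') = ∞}) := by
  obtain ⟨κ, hκ, hle⟩ := hζ.exists_mul_measure_le_measure_le_tsum h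
  refine ⟨κ, hκ, fun φ hφ hint ℓ n D hD hDn hDℓ => ?_⟩
  have hsum : Measurable fun ω' => ∑' m, φ (ζ m ω') :=
    .tsum fun m => hφ.antitone.measurable.comp (hζ.measurable m)
  have htop : {ω' | ∑' m, φ (ζ m ω') = ∞} = ⋂ M : ℕ, {ω' | M ≤ ∑' m, φ (ζ m ω')} := by
    ext ω'
    simp only [mem_iInter, mem_ofPred_eq]
    refine ⟨fun hω' M => hω' ▸ le_top, fun hω' => ?_⟩
    by_contra hne
    obtain ⟨M, hM⟩ := ENNReal.exists_nat_gt hne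
    exact (hω' M).not_gt hM
  rw [htop, inter_iInter, Antitone.measure_iInter]
  · exact le_iInf fun M => hle φ hφ hint M ℓ n D hD hDn hDℓ
  · exact fun M M' hM => inter_subset_inter_right _ fun ω' hω' =>
      le_trans (Nat.cast_le.2 hM) (show (M' : ℝ≥0∞) ≤ _ from hω')
  · exact fun M => ((hζ.measurable_path hD).inter
      (measurableSet_le measurable_const hsum)).nullMeasurableSet
  · exact ⟨0, measure_ne_top _ _⟩

lemma exists_mul_measure_le_measure_tsum_eq_top (h : IsCenteredSteps P X) :
    ∃ κ : ℝ≥0∞, κ ≠ 0 ∧ ∀ φ, IsProfile 0 φ → ∫⁻ y, φ y ∂heightMeasure = ∞ →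
      ∀ n D, MeasurableSet D → DependsOn (· ∈ D) (Iic n) →
        κ * P' {ω' | (fun k => ζ k ω') ∈ D} ≤
          P' ({ω' | (fun k => ζ k ω') ∈ D} ∩ {ω' | ∑' m, φ (ζ m ω') = ∞}) := by
  obtain ⟨κ, hκ, hle⟩ := hζ.exists_mul_measure_le_measure_tsum_eq_top_of_forall_le h
  refine ⟨κ, hκ, fun φ hφ hint n D hD hDn => ?_⟩
  set low : ℕ → Set (ℕ → ℝ) := fun ℓ => D ∩ {v | v n ≤ ℓ}
  have hlow_meas (ℓ : ℕ) : MeasurableSet (low ℓ) :=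
    hD.inter (measurableSet_le (measurable_pi_apply n) measurable_const)
  have hlow_dep (ℓ : ℕ) : DependsOn (· ∈ low ℓ) (Iic n) := fun u v huv =>
    congr_arg₂ And (hDn huv) (congr_arg (· ≤ (ℓ : ℝ)) (huv n self_mem_Iic))
  have hcover : {ω' | (fun k => ζ k ω') ∈ D} = ⋃ ℓ, {ω' | (fun k => ζ k ω') ∈ low ℓ} := by
    ext ω'
    simp only [low, mem_ofPred_eq, mem_iUnion, mem_inter_iff, exists_and_left]
    exact ⟨fun hω' => ⟨hω', exists_nat_ge _⟩, And.left⟩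
  have hmono : Monotone fun ℓ => {ω' | (fun k => ζ k ω') ∈ low ℓ} := fun ℓ ℓ' hℓ ω' hω' =>
    ⟨hω'.1, le_trans (show ζ n ω' ≤ ℓ from hω'.2) (Nat.cast_le.2 hℓ)⟩
  calc κ * P' {ω' | (fun k => ζ k ω') ∈ D} = ⨆ ℓ, κ * P' {ω' | (fun k => ζ k ω') ∈ low ℓ} := by
        rw [hcover, hmono.measure_iUnion, ENNReal.mul_iSup]
    _ ≤ P' ({ω' | (fun k => ζ k ω') ∈ D} ∩ {ω' | ∑' m, φ (ζ m ω') = ∞}) := iSup_le fun ℓ =>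
        (hle φ hφ hint ℓ n (low ℓ) (hlow_meas ℓ) (hlow_dep ℓ) fun v hv => hv.2).trans
          (measure_mono (inter_subset_inter_left _ fun ω' hω' => hω'.1))

lemma ae_tsum_eq_top (h : IsCenteredSteps P X) {φ : ℝ → ℝ≥0∞} (hφ : IsProfile 0 φ)
    (hint : ∫⁻ y, φ y ∂heightMeasure = ∞) : ∀ᵐ ω' ∂P', ∑' m, φ (ζ m ω') = ∞ := by
  obtain ⟨κ, hκ, hle⟩ := hζ.exists_mul_measure_le_measure_tsum_eq_top h
  have hsum : Measurable fun v : ℕ → ℝ => ∑' m, φ (v m) :=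
    .tsum fun m => hφ.antitone.measurable.comp (measurable_pi_apply m)
  have htop : MeasurableSet {v : ℕ → ℝ | ∑' m, φ (v m) = ∞} := hsum (measurableSet_singleton ∞)
  have hnull : P'.map (fun ω' k => ζ k ω') {v | ∑' m, φ (v m) = ∞}ᶜ = 0 := by
    refine measure_compl_eq_zero_of_cylinders htop (κ := min κ 1) (by simp [hκ])
      (ne_top_of_le_ne_top ENNReal.one_ne_top (min_le_right _ _)) fun D hD => ?_
    obtain ⟨n, hDn⟩ := exists_dependsOn_of_mem_measurableCylinders hD
    have hDm := MeasurableSet.of_mem_measurableCylinders hD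
    rw [Measure.map_apply hζ.measurable_path hDm,
      Measure.map_apply hζ.measurable_path (hDm.inter htop)]
    exact (mul_le_mul_left (min_le_left _ _) _).trans (hle φ hφ hint n D hDm hDn)
  rwa [Measure.map_apply hζ.measurable_path htop.compl] at hnull

lemma ae_tsum_eq_top_iff [NeZero P'] (h : IsCenteredSteps P X) {φ : ℝ → ℝ≥0∞}
    (hφ : IsProfile 0 φ) :
    (∀ᵐ ω' ∂P', ∑' m, φ (ζ m ω') = ∞) ↔ ∫⁻ y, φ y ∂heightMeasure = ∞ := by
  refine ⟨fun htop => ?_, hζ.ae_tsum_eq_top h hφ⟩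
  by_contra hfin
  obtain ⟨C, hC, hle⟩ := hζ.exists_lintegral_tsum_le h
  have hmean : ∫⁻ ω', ∑' m, φ (ζ m ω') ∂P' ≠ ∞ := ne_top_of_le_ne_top (by finiteness) (hle φ hφ)
  refine hmean ?_
  rw [lintegral_congr_ae htop, lintegral_const, ENNReal.top_mul (NeZero.ne _)]

end IsConditionedToStayPositive

end Divergence

section RealProfile

variable {F : ℝ → ℝ}

lemma isProfile_ofReal_comp_max (hF : AntitoneOn F (Ici 0)) :
    IsProfile 0 fun y => ENNReal.ofReal (F (max y 0)) where
  antitone x y hxy := ENNReal.ofReal_le_ofReal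
    (hF (le_max_right x 0) (le_max_right y 0) (max_le_max_right 0 hxy))
  ne_top _ := ENNReal.ofReal_ne_top
  eq_of_le y hy := by rw [max_eq_right hy, max_self]

lemma lintegral_ofReal_comp_max_eq_top_iff (hF0 : ∀ y, 0 ≤ y → 0 ≤ F y)
    (hF : AntitoneOn F (Ici 0)) :
    ∫⁻ y, ENNReal.ofReal (F (max y 0)) ∂heightMeasure = ∞ ↔
      ∫⁻ y in Ici 0, ENNReal.ofReal (F y * y) = ∞ := by
  have hdensity : ∫⁻ y in Ici (0 : ℝ), ENNReal.ofReal (F (max y 0)) * ENNReal.ofReal y =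
      ∫⁻ y in Ici 0, ENNReal.ofReal (F y * y) :=
    setLIntegral_congr_fun measurableSet_Ici fun y (hy : 0 ≤ y) => by
      rw [max_eq_left hy, ENNReal.ofReal_mul (hF0 y hy)]
  rw [lintegral_heightMeasure (isProfile_ofReal_comp_max hF).antitone.measurable, hdensity,
    ENNReal.add_eq_top, or_iff_right ENNReal.ofReal_ne_top]

end RealProfile

end ConditionedWalk

end

theorem proposition2p6 {Ω Ω' : Type*} [MeasurableSpace Ω] [MeasurableSpace Ω']
    (P : Measure Ω) [IsProbabilityMeasure P] (P' : Measure Ω') [IsProbabilityMeasure P']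
    (X : ℕ → Ω → ℝ) (hXm : ∀ n, Measurable (X n))
    (hXindep : iIndepFun X P) (hXident : ∀ n, IdentDistrib (X n) (X 0) P P)
    (hXL2 : MemLp (X 0) 2 P) (hXmean : ∫ ω, X 0 ω ∂P = 0)
    (hXvar : 0 < variance (X 0) P)
    (ζ : ℕ → Ω' → ℝ)
    (hζ : ConditionedWalk.IsConditionedToStayPositive P (ConditionedWalk.walk X) P' ζ)
    (F : ℝ → ℝ) (hFnonneg : ∀ y, 0 ≤ y → 0 ≤ F y) (hFanti : AntitoneOn F (Ici 0)) :
    (∫⁻ y in Ici (0 : ℝ), ENNReal.ofReal (F y * y)) = ∞ ↔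
      ∀ᵐ ω' ∂P', ∑' n : ℕ, ENNReal.ofReal (F (ζ n ω')) = ∞ := by
  have h : ConditionedWalk.IsCenteredSteps P X :=
    ⟨⟨hXm, hXindep, hXident⟩, hXL2, hXmean, hXvar⟩
  have hprofile := ConditionedWalk.isProfile_ofReal_comp_max hFanti
  rw [← ConditionedWalk.lintegral_ofReal_comp_max_eq_top_iff hFnonneg hFanti,
    ← hζ.ae_tsum_eq_top_iff h hprofile]
  refine Filter.eventually_congr ?_
  filter_upwards [hζ.ae_nonneg h.toIsIIDSteps] with ω' hω'
  simp only [max_eq_left (hω' _)]
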